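/- For $t \ge 0$ let $N(t)$ be the number of points $n \in \mathbb{Z}^2$ with $|n| \le \sqrt{t}/(2\pi)$ (Euclidean length), let $D(t) = N(t) - \frac{t}{4\pi}$, and for $R > 0$ let $A(R) = \frac{1}{R}\int_0^R D(t)\,dt$. The series $$g(x) = -\frac{\sqrt{2}}{\pi^{3/2}} \sum_{n \in \mathbb{Z}^2,\ n \neq 0} |n|^{-5/2} \cos\left(|n|x - \frac{\pi}{4}\right), \qquad x \in \mathbb{R},$$ converges absolutely and defines a uniformly (Bohr) almost periodic function of mean value zero, and $$A(R) = g(R^{1/2})R^{-1/4} + O(R^{-3/4}) \quad \text{as } R \to \infty.$$ More generally, there exists a sequence of uniformly almost periodic functions $g_1, g_2, \dots$ on $\mathbb{R}$ with $g_1 = g$ such that for every integer $n \ge 1$, $$A(R) = \sum_{j=1}^n g_j(R^{1/2})R^{\frac14 - \frac{j}{2}} + O(R^{-\frac14 - \frac{n}{2}}) \quad \text{as } R \to \infty,$$ where the constant in the $O$ may depend on $n$. Here a function $f : \mathbb{R} \to \mathbb{R}$ is uniformly almost periodic if it is continuous and for every $\varepsilon > 0$ there is $L > 0$ such that every closed interval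 of length $L$ contains a $\tau$ with $|f(x+\tau) - f(x)| \le \varepsilon$ for all $x \in \mathbb{R}$, and it has mean value zero if $\frac{1}{2T}\int_{-T}^{T} f(x)\,dx \to 0$ as $T \to \infty$. -/

import Mathlib

open Filter Topology Asymptotics MeasureTheory

noncomputable section

namespace LatticeDisk

/-- The Euclidean length `|n|` of a lattice point `n ∈ ℤ²`. -/
def eNorm (n : ℤ × ℤ) : ℝ := Real.sqrt ((n.1 : ℝ) ^ 2 + (n.2 : ℝ) ^ 2)

/-- The lattice points of `ℤ²` in the closed disk of radius `√t / 2π` about the origin. -/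
def diskPoints (t : ℝ) : Set (ℤ × ℤ) := {n | eNorm n ≤ Real.sqrt t / (2 * Real.pi)}

/-- The counting function `N(t)`. -/
def N (t : ℝ) : ℕ := (diskPoints t).ncard

/-- The error `D(t) = N(t) - t / 4π`. -/
def D (t : ℝ) : ℝ := (N t : ℝ) - t / (4 * Real.pi)

/-- The average `A(R) = (1/R) ∫₀ᴿ D(t) dt`. -/
def A (R : ℝ) : ℝ := (1 / R) * ∫ t in (0 : ℝ)..R, D t

/-- The term with index `n` of the series that defines `g(x)`, without the constant in front. -/
def gTerm (x : ℝ) (n : {n : ℤ × ℤ // n ≠ 0}) : ℝ :=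
  eNorm n.1 ^ (-(5 / 2) : ℝ) * Real.cos (eNorm n.1 * x - Real.pi / 4)

/-- `g(x) = -(√2 / π^{3/2}) ∑_{n ≠ 0} |n|^{-5/2} cos(|n| x - π/4)`, the sum over `ℤ² \ {0}`. -/
def g (x : ℝ) : ℝ :=
  -(Real.sqrt 2 / Real.pi ^ (3 / 2 : ℝ)) * ∑' n : {n : ℤ × ℤ // n ≠ 0}, gTerm x n

/-- Uniformly almost periodic functions on the line, in the sense of Bohr: continuous, and for
every `ε > 0` there is a length `L` such that every interval of length `L` contains an
`ε`-translation number `τ` of `f`. -/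
def IsUniformlyAlmostPeriodic (f : ℝ → ℝ) : Prop :=
  Continuous f ∧ ∀ ε > 0, ∃ L > 0, ∀ a : ℝ, ∃ τ ∈ Set.Icc a (a + L), ∀ x : ℝ,
    |f (x + τ) - f x| ≤ ε

/-- `f` has mean value `m`: `(1/2T) ∫_{-T}^{T} f(x) dx → m` as `T → ∞`. -/
def HasMeanValue (f : ℝ → ℝ) (m : ℝ) : Prop :=
  Tendsto (fun T : ℝ => (1 / (2 * T)) * ∫ x in (-T)..T, f x) atTop (𝓝 m)

/-- The disk contains finitely many lattice points, so that `N t` is the honest count. -/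
theorem diskPoints_finite (t : ℝ) : (diskPoints t).Finite := by
  obtain ⟨M, hM⟩ := exists_nat_ge (Real.sqrt t / (2 * Real.pi))
  refine ((Set.finite_Icc (-(M : ℤ)) M).prod (Set.finite_Icc (-(M : ℤ)) M)).subset ?_
  intro n hn
  have hn' : eNorm n ≤ M := le_trans hn hM
  have h1 : |(n.1 : ℝ)| ≤ M :=
    le_trans (Real.abs_le_sqrt (by nlinarith [sq_nonneg (n.2 : ℝ)])) hn'
  have h2 : |(n.2 : ℝ)| ≤ M :=
    le_trans (Real.abs_le_sqrt (by nlinarith [sq_nonneg (n.1 : ℝ)])) hn'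
  rw [abs_le] at h1 h2
  refine ⟨⟨?_, ?_⟩, ⟨?_, ?_⟩⟩
  · exact_mod_cast h1.1
  · exact_mod_cast h1.2
  · exact_mod_cast h2.1
  · exact_mod_cast h2.2

theorem N_mono : Monotone N := by
  intro s t hst
  refine Set.ncard_le_ncard ?_ (diskPoints_finite t)
  intro n hn
  refine le_trans (show eNorm n ≤ _ from hn) ?_
  have := Real.sqrt_le_sqrt hst
  gcongr

/-- `D` is integrable on bounded intervals, so that the integral in `A` is the honest one. -/
theorem D_intervalIntegrable (a b : ℝ) : IntervalIntegrable D volume a b := by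
  have h : Monotone fun t => (N t : ℝ) := fun s t hst => Nat.cast_le.mpr (N_mono hst)
  have h2 : IntervalIntegrable (fun t : ℝ => t / (4 * Real.pi)) volume a b :=
    (by fun_prop : Continuous fun t : ℝ => t / (4 * Real.pi)).intervalIntegrable a b
  exact h.intervalIntegrable.sub h2

end LatticeDisk

end

/-!
Poisson summation turns the average error into an exact series. Integrating the count gives
`∫₀ᴿ N(t) dt = ∑ₙ max (R - 4π²|n|²) 0`, a sum over `ℤ²` of values of a paraboloid cap. The cap is
continuous, and its Fourier transform decays like `|k|^{-5/2}`, so Poisson summation applies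
(`tsum_cap_eq_tsum_capHat`); it is carried out one variable at a time, from the one-dimensional
formula. The cap is radial, hence its transform at `k` depends on `|k|` only and equals a multiple
of `Ψ(√R |k|)`, where `Ψ(z) = ∫_{-1}^1 (1 - u²)^{3/2} cos(zu) du` (`capHat_eq_Psi`). The frequency
`k = 0` cancels the area term, which leaves
`A(R) = R / (3π²) · ∑_{k ≠ 0} Ψ(√R |k|)` (`A_eq_tsum_Psi`).

The expansion of `A` is that of `Ψ`, summed over `k`. Moving the segment `[-1, 1]` to the two
vertical half-lines above `±1` writes `Ψ(z)` as `2 Im (e^{iz} H(z))` with the Laplace integral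
`H(z) = ∫₀^∞ y^{3/2} (y - 2i)^{3/2} e^{-zy} dy` (`Psi_eq_hankelIntegral`), and the Taylor expansion
of `(y - 2i)^{3/2}`, with a remainder controlled on the whole half-line, gives
`Ψ(z) = ∑_{m<n} Re (a_m e^{iz}) z^{-5/2-m} + O(z^{-5/2-n})` for `z ≥ 1` (`Psi_expansion`). Since
`∑_{k ≠ 0} |k|^{-5/2-m}` converges, the `m`-th terms add up to an absolutely convergent
trigonometric series in `√R`, and the remainders to `O(R^{-1/4-n/2})` (`A_expansion`); the value of
`a₀` identifies the first series with `g` (`apTerm_zero`).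

An absolutely convergent series of exponentials is almost periodic because finitely many of its
terms dominate and finitely many exponentials have relatively dense common near-periods
(`isUniformlyAlmostPeriodic_expSum`), and its mean value is zero as the frequencies are at least `1`
(`hasMeanValue_expSum`).
-/

namespace LatticeDisk

open scoped FourierTransform

/-! ### Almost periodicity of absolutely convergent trigonometric series -/

/-- The real trigonometric series `∑ Re (c_k e^{i λ_k x})` with complex amplitudes `c` and
frequencies `λ`. -/
noncomputable def expSum {ι : Type*} (c : ι → ℂ) (l : ι → ℝ) (x : ℝ) : ℝ :=
  ∑' k, (c k * Complex.exp ((l k * x : ℝ) * Complex.I)).re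

lemma norm_expSum_term_le (c : ℂ) (y : ℝ) :
    ‖(c * Complex.exp ((y : ℝ) * Complex.I)).re‖ ≤ ‖c‖ := by
  refine (Complex.abs_re_le_norm _).trans ?_
  rw [norm_mul, Complex.norm_exp_ofReal_mul_I, mul_one]

lemma summable_expSum {ι : Type*} {c : ι → ℂ} (hc : Summable fun k => ‖c k‖) (l : ι → ℝ) (x : ℝ) :
    Summable fun k => (c k * Complex.exp ((l k * x : ℝ) * Complex.I)).re :=
  Summable.of_norm_bounded hc fun _ => norm_expSum_term_le _ _

lemma continuous_expSum {ι : Type*} {c : ι → ℂ} (hc : Summable fun k => ‖c k‖) (l : ι → ℝ) :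
    Continuous (expSum c l) :=
  continuous_tsum (fun k => by fun_prop) hc fun k x => norm_expSum_term_le _ _

/-- Simultaneous near-periods of finitely many exponentials are relatively dense: the curve
`τ ↦ (e^{i λ_k τ})_k` has totally bounded range, so it returns near one of finitely many of its
own points from every starting time. -/
lemma exists_common_translation {ι : Type*} (s : Finset ι) (l : ι → ℝ) {δ : ℝ} (hδ : 0 < δ) :
    ∃ L > 0, ∀ a : ℝ, ∃ τ ∈ Set.Icc a (a + L), ∀ k ∈ s,
      ‖Complex.exp ((l k * τ : ℝ) * Complex.I) - 1‖ ≤ δ := by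
  let Φ : ℝ → (s → ℂ) := fun t k => Complex.exp ((l k * t : ℝ) * Complex.I)
  have htb : TotallyBounded (Set.range Φ) := by
    refine (isCompact_closedBall (0 : s → ℂ) 1).totallyBounded.subset ?_
    rintro _ ⟨t, rfl⟩
    rw [mem_closedBall_zero_iff, pi_norm_le_iff_of_nonneg zero_le_one]
    intro k
    exact (Complex.norm_exp_ofReal_mul_I _).le
  obtain ⟨t, hts, htf, hcov⟩ := Metric.finite_approx_of_totallyBounded htb δ hδ
  choose! p hp using fun y (hy : y ∈ t) => hts hy
  obtain ⟨M, hM⟩ := (htf.image fun y => |p y|).bddAbove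
  refine ⟨2 * |M| + 1, by positivity, fun a => ?_⟩
  obtain ⟨y, hy, hball⟩ := Set.mem_iUnion₂.1 (hcov ⟨a + |M|, rfl⟩)
  have hpy : |p y| ≤ |M| := (hM ⟨y, hy, rfl⟩).trans (le_abs_self M)
  rw [abs_le] at hpy
  refine ⟨a + |M| - p y, ⟨by linarith, by linarith⟩, fun k hk => ?_⟩
  rw [← hp y hy, Metric.mem_ball, dist_eq_norm] at hball
  have h1 := (norm_le_pi_norm (Φ (a + |M|) - Φ (p y)) ⟨k, hk⟩).trans hball.le
  have h2 : Complex.exp ((l k * (a + |M| - p y) : ℝ) * Complex.I) - 1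
      = Complex.exp (((-(l k * p y) : ℝ)) * Complex.I) *
        ((Φ (a + |M|) - Φ (p y)) ⟨k, hk⟩) := by
    simp only [Φ, Pi.sub_apply, mul_sub, ← Complex.exp_add]
    congr 1
    · congr 1
      push_cast
      ring
    · rw [← Complex.exp_zero]
      congr 1
      push_cast
      ring
  rw [h2, norm_mul, Complex.norm_exp_ofReal_mul_I, one_mul]
  exact h1

theorem isUniformlyAlmostPeriodic_expSum {ι : Type*} {c : ι → ℂ} (hc : Summable fun k => ‖c k‖)
    (l : ι → ℝ) : IsUniformlyAlmostPeriodic (expSum c l) := by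
  refine ⟨continuous_expSum hc l, fun ε hε => ?_⟩
  set S := ∑' k, ‖c k‖ with hS
  have hS0 : 0 ≤ S := tsum_nonneg fun k => norm_nonneg _
  -- a finite set carrying all but `ε / 4` of the total amplitude
  obtain ⟨s, hs⟩ := ((tendsto_order.1 hc.hasSum).1 (S - ε / 4) (by linarith)).exists
  obtain ⟨L, hL, h⟩ := exists_common_translation s l (δ := ε / (2 * (S + 1))) (by positivity)
  refine ⟨L, hL, fun a => ?_⟩
  obtain ⟨τ, hτ, hk⟩ := h a
  refine ⟨τ, hτ, fun x => ?_⟩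
  have hd : ∀ k, ‖(c k * Complex.exp ((l k * (x + τ) : ℝ) * Complex.I)).re
      - (c k * Complex.exp ((l k * x : ℝ) * Complex.I)).re‖
      ≤ ‖c k‖ * ‖Complex.exp ((l k * τ : ℝ) * Complex.I) - 1‖ := by
    intro k
    have : c k * Complex.exp ((l k * (x + τ) : ℝ) * Complex.I)
        - c k * Complex.exp ((l k * x : ℝ) * Complex.I) =
        (c k * Complex.exp ((l k * τ : ℝ) * Complex.I) - c k) *
          Complex.exp ((l k * x : ℝ) * Complex.I) := by
      rw [sub_mul, mul_assoc (c k) _ (Complex.exp _), ← Complex.exp_add]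
      congr 3
      push_cast
      ring
    rw [← Complex.sub_re, this]
    refine (norm_expSum_term_le _ _).trans ?_
    rw [← norm_mul, mul_sub, mul_one]
  have h2 : ∀ k, ‖Complex.exp ((l k * τ : ℝ) * Complex.I) - 1‖ ≤ 2 := fun k => by
    refine (norm_sub_le _ _).trans ?_
    rw [Complex.norm_exp_ofReal_mul_I, norm_one]
    norm_num
  have hsum : Summable fun k => ‖c k‖ * ‖Complex.exp ((l k * τ : ℝ) * Complex.I) - 1‖ :=
    Summable.of_nonneg_of_le (fun k => by positivity)
      (fun k => mul_le_mul_of_nonneg_left (h2 k) (norm_nonneg _)) (hc.mul_right 2)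
  unfold expSum
  rw [← Summable.tsum_sub (summable_expSum hc l _) (summable_expSum hc l _), ← Real.norm_eq_abs]
  refine (tsum_of_norm_bounded hsum.hasSum hd).trans ?_
  have hcs := hc.sum_add_tsum_compl (s := s)
  rw [← hsum.sum_add_tsum_compl (s := s)]
  have h3 : ∑ k ∈ s, ‖c k‖ * ‖Complex.exp ((l k * τ : ℝ) * Complex.I) - 1‖ ≤ ε / 2 := by
    calc _ ≤ ∑ k ∈ s, ‖c k‖ * (ε / (2 * (S + 1))) :=
          Finset.sum_le_sum fun k hks => mul_le_mul_of_nonneg_left (hk k hks) (norm_nonneg _)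
      _ = (∑ k ∈ s, ‖c k‖) * (ε / (2 * (S + 1))) := by rw [Finset.sum_mul]
      _ ≤ (S + 1) * (ε / (2 * (S + 1))) := by
          gcongr
          linarith [hc.sum_le_tsum s fun k _ => norm_nonneg (c k)]
      _ = ε / 2 := by field_simp
  have h4 : ∑' k : ((s : Set ι)ᶜ : Set ι),
      ‖c k‖ * ‖Complex.exp ((l k * τ : ℝ) * Complex.I) - 1‖ ≤
      ∑' k : ((s : Set ι)ᶜ : Set ι), ‖c k‖ * 2 :=
    Summable.tsum_le_tsum (fun k => mul_le_mul_of_nonneg_left (h2 k) (norm_nonneg _))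
      (hsum.subtype _) ((hc.subtype _).mul_right 2)
  rw [tsum_mul_right] at h4
  linarith

lemma hasSum_integral_expSum {ι : Type*} [Countable ι] {c : ι → ℂ} (hc : Summable fun k => ‖c k‖)
    (l : ι → ℝ) (a b : ℝ) :
    HasSum (fun k => ∫ x in a..b, (c k * Complex.exp ((l k * x : ℝ) * Complex.I)).re)
      (∫ x in a..b, expSum c l x) := by
  refine intervalIntegral.hasSum_integral_of_dominated_convergence (fun k _ => ‖c k‖)
    (fun k => (by fun_prop : Continuous fun x : ℝ =>
      (c k * Complex.exp ((l k * x : ℝ) * Complex.I)).re).aestronglyMeasurable)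
    (fun k => Eventually.of_forall fun x _ => norm_expSum_term_le _ _)
    (Eventually.of_forall fun _ _ => hc) (by simp)
    (Eventually.of_forall fun x _ => (summable_expSum hc l x).hasSum)

/-- If all frequencies are at least `1`, the integrals of the terms are bounded by twice the
amplitudes, so the integral of the series stays bounded and its mean value is `0`. -/
theorem hasMeanValue_expSum {ι : Type*} [Countable ι] {c : ι → ℂ} (hc : Summable fun k => ‖c k‖)
    {l : ι → ℝ} (hl : ∀ k, 1 ≤ l k) : HasMeanValue (expSum c l) 0 := by
  have hterm : ∀ (k : ι) (T : ℝ),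
      ‖∫ x in (-T)..T, (c k * Complex.exp ((l k * x : ℝ) * Complex.I)).re‖ ≤ ‖c k‖ * 2 := by
    intro k T
    have hne : ((l k : ℂ) * Complex.I) ≠ 0 :=
      mul_ne_zero (Complex.ofReal_ne_zero.2 (by linarith [hl k])) Complex.I_ne_zero
    have hre := intervalIntegral.intervalIntegral_re (𝕜 := ℂ) (μ := volume) (a := -T) (b := T)
      (f := fun x : ℝ => c k * Complex.exp ((l k * x : ℝ) * Complex.I))
      (Continuous.intervalIntegrable (by fun_prop) _ _)
    simp only [RCLike.re_eq_complex_re] at hre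
    have h_int := integral_exp_mul_complex (a := -T) (b := T) hne
    have hfun : ∀ x : ℝ, Complex.exp ((l k * x : ℝ) * Complex.I)
        = Complex.exp ((l k : ℂ) * Complex.I * x) := fun x => by
      congr 1
      push_cast
      ring
    rw [hre, intervalIntegral.integral_const_mul]
    simp_rw [hfun]
    rw [h_int, ← hfun, ← hfun]
    refine (Complex.abs_re_le_norm _).trans ?_
    rw [norm_mul, norm_div, norm_mul, Complex.norm_I, mul_one, Complex.norm_real,
      Real.norm_of_nonneg (by linarith [hl k])]
    refine mul_le_mul_of_nonneg_left ?_ (norm_nonneg _)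
    rw [div_le_iff₀ (by linarith [hl k])]
    refine (norm_sub_le _ _).trans ?_
    rw [Complex.norm_exp_ofReal_mul_I, Complex.norm_exp_ofReal_mul_I]
    linarith [hl k]
  have hb : ∀ T : ℝ, ‖∫ x in (-T)..T, expSum c l x‖ ≤ (∑' k, ‖c k‖) * 2 := by
    intro T
    rw [← (hasSum_integral_expSum hc l _ _).tsum_eq]
    exact tsum_of_norm_bounded (hc.hasSum.mul_right 2) fun k => hterm k T
  have h0 : Tendsto (fun T : ℝ => 1 / (2 * T)) atTop (𝓝 0) := by
    simp_rw [one_div]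
    exact (tendsto_id.const_mul_atTop two_pos).inv_tendsto_atTop
  exact h0.zero_mul_isBoundedUnder_le (isBoundedUnder_of ⟨_, hb⟩)

/-! ### Lattice sums -/

lemma one_le_eNorm {n : ℤ × ℤ} (hn : n ≠ 0) : 1 ≤ eNorm n := by
  unfold eNorm
  rw [Real.one_le_sqrt]
  have h : 1 ≤ n.1 ^ 2 + n.2 ^ 2 := by
    by_contra! h
    have h1 : n.1 = 0 := by nlinarith [sq_nonneg n.1, sq_nonneg n.2]
    have h2 : n.2 = 0 := by nlinarith [sq_nonneg n.1, sq_nonneg n.2]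
    exact hn (Prod.ext h1 h2)
  exact_mod_cast h

lemma summable_eNorm_rpow {s : ℝ} (hs : 2 < s) : Summable fun n : ℤ × ℤ => eNorm n ^ (-s) := by
  have h := (finTwoArrowEquiv ℤ).symm.summable_iff.2
    (EisensteinSeries.summable_one_div_norm_rpow hs)
  refine Summable.of_nonneg_of_le (fun n => Real.rpow_nonneg (Real.sqrt_nonneg _) _) (fun n => ?_) h
  -- `0 ^ (-s) = 0` for `s ≠ 0`, so the term at the origin is harmless
  rcases eq_or_ne n 0 with rfl | hn
  · have : eNorm (0 : ℤ × ℤ) = 0 := by simp [eNorm]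
    rw [this, Real.zero_rpow (by linarith)]
    exact Real.rpow_nonneg (norm_nonneg _) _
  · have hpos : 0 < ‖(finTwoArrowEquiv ℤ).symm n‖ := by
      rw [norm_pos_iff]
      intro h0
      exact hn ((finTwoArrowEquiv ℤ).symm.injective (h0.trans (by ext i; fin_cases i <;> rfl)))
    refine Real.rpow_le_rpow_of_nonpos hpos ?_ (by linarith)
    refine (pi_norm_le_iff_of_nonneg (Real.sqrt_nonneg _)).2 ?_
    intro i
    fin_cases i
    · exact (Int.norm_eq_abs _).trans_le (Real.abs_le_sqrt
        (show (n.1 : ℝ) ^ 2 ≤ _ by nlinarith [sq_nonneg (n.2 : ℝ)]))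
    · exact (Int.norm_eq_abs _).trans_le (Real.abs_le_sqrt
        (show (n.2 : ℝ) ^ 2 ≤ _ by nlinarith [sq_nonneg (n.1 : ℝ)]))

/-! ### The Fourier integral of `(1 - u²)^{3/2}` -/

/-- `Ψ(z) = ∫_{-1}^1 (1 - u²)^{3/2} cos(zu) du`, which is `3π z⁻² J₂(z)` for `z > 0`. -/
noncomputable def Psi (z : ℝ) : ℝ :=
  ∫ u in (-1 : ℝ)..1, (1 - u ^ 2) ^ (3 / 2 : ℝ) * Real.cos (z * u)

/-- The integrand of `Psi`, with `cos(zu)` replaced by `e^{izu}`, extended to complex `u`. -/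
noncomputable def psiKernel (z : ℝ) (u : ℂ) : ℂ :=
  (1 - u ^ 2) ^ ((3 / 2 : ℝ) : ℂ) * Complex.exp (z * u * Complex.I)

lemma one_sub_sq_re (u : ℂ) : (1 - u ^ 2).re = 1 - u.re ^ 2 + u.im ^ 2 := by
  simp [pow_two]
  ring

/-- On the closed strip `|Re u| ≤ 1` the base `1 - u²` has nonnegative real part, so the principal
branch of its power is continuous there, the branch points `±1` included. -/
lemma continuousAt_psiKernel (z : ℝ) {u : ℂ} (h1 : -1 ≤ u.re) (h2 : u.re ≤ 1) :
    ContinuousAt (psiKernel z) u := by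
  have h : ContinuousAt (fun w : ℂ => w ^ ((3 / 2 : ℝ) : ℂ)) (1 - u ^ 2) :=
    Complex.continuousAt_cpow_const_of_re_pos
      (Or.inl (by rw [one_sub_sq_re]; nlinarith [sq_nonneg u.im]))
      (by rw [Complex.ofReal_re]; norm_num)
  exact (ContinuousAt.comp (f := fun u : ℂ => 1 - u ^ 2) h (by fun_prop)).mul (by fun_prop)

lemma differentiableAt_psiKernel (z : ℝ) {u : ℂ} (h1 : -1 < u.re) (h2 : u.re < 1) :
    DifferentiableAt ℂ (psiKernel z) u := by
  have hs : (1 - u ^ 2) ∈ Complex.slitPlane :=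
    Or.inl (by rw [one_sub_sq_re]; nlinarith [sq_nonneg u.im])
  have h : DifferentiableAt ℂ (fun u : ℂ => (1 - u ^ 2) ^ ((3 / 2 : ℝ) : ℂ)) u :=
    DifferentiableAt.cpow_const (by fun_prop) hs
  exact h.mul (by fun_prop)

lemma integral_psiKernel_re (z : ℝ) :
    (∫ x in (-1 : ℝ)..1, psiKernel z x).re = Psi z := by
  have hc : ContinuousOn (fun x : ℝ => psiKernel z x) (Set.uIcc (-1) 1) := by
    intro x hx
    rw [Set.uIcc_of_le (by norm_num)] at hx
    exact (ContinuousAt.comp (f := fun x : ℝ => (x : ℂ))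
      (continuousAt_psiKernel z hx.1 hx.2) (by fun_prop)).continuousWithinAt
  have hre := intervalIntegral.intervalIntegral_re (𝕜 := ℂ) (μ := volume) hc.intervalIntegrable
  simp only [RCLike.re_eq_complex_re] at hre
  rw [← hre]
  refine intervalIntegral.integral_congr fun x hx => ?_
  rw [Set.uIcc_of_le (by norm_num)] at hx
  have h0 : 0 ≤ 1 - x ^ 2 := by nlinarith [hx.1, hx.2]
  have h1 : ((1 : ℂ) - (x : ℂ) ^ 2) = ((1 - x ^ 2 : ℝ) : ℂ) := by push_cast; ring
  have h2 : (z * x * Complex.I : ℂ) = ((z * x : ℝ) : ℂ) * Complex.I := by push_cast; ring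
  simp only [psiKernel]
  rw [h1, h2, ← Complex.ofReal_cpow h0, Complex.re_ofReal_mul, Complex.exp_ofReal_mul_I_re]

/-- The kernel takes conjugate values on the two vertical sides, so their contributions to the
contour integral combine into an imaginary part. -/
lemma psiKernel_left (z : ℝ) (y : ℝ) :
    psiKernel z (((-1 : ℝ) : ℂ) + y * Complex.I)
      = (starRingEnd ℂ) (psiKernel z (((1 : ℝ) : ℂ) + y * Complex.I)) := by
  have harg : (1 - (((1 : ℝ) : ℂ) + y * Complex.I) ^ 2).arg ≠ Real.pi := by
    rw [Ne, Complex.arg_eq_pi_iff, one_sub_sq_re, not_and]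
    intro h
    simp at h
    nlinarith [sq_nonneg y]
  have h1 : 1 - (((-1 : ℝ) : ℂ) + y * Complex.I) ^ 2
      = (starRingEnd ℂ) (1 - (((1 : ℝ) : ℂ) + y * Complex.I) ^ 2) := by
    simp
    ring
  simp only [psiKernel]
  rw [h1, Complex.conj_cpow _ _ harg, map_mul, ← Complex.exp_conj, Complex.conj_ofReal]
  congr 2
  simp
  ring

lemma tendsto_integral_psiKernel_top {z : ℝ} (hz : 0 < z) :
    Tendsto (fun T : ℝ => ∫ x in (-1 : ℝ)..1, psiKernel z (x + T * Complex.I)) atTop (𝓝 0) := by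
  have hb : ∀ T : ℝ, 1 ≤ T → ‖∫ x in (-1 : ℝ)..1, psiKernel z (x + T * Complex.I)‖
      ≤ 50 * (T ^ 4 / Real.exp (z * T)) := by
    intro T hT
    have := intervalIntegral.norm_integral_le_of_norm_le_const (a := (-1 : ℝ)) (b := 1)
      (f := fun x : ℝ => psiKernel z (x + T * Complex.I)) (C := 25 * (T ^ 4 / Real.exp (z * T))) ?_
    · refine this.trans (le_of_eq ?_)
      norm_num
      ring
    · intro x hx
      rw [Set.uIoc_of_le (by norm_num)] at hx
      have hx1 : |x| ≤ 1 := abs_le.2 ⟨hx.1.le, hx.2⟩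
      have hu : ‖(x : ℂ) + T * Complex.I‖ ≤ 2 * T := by
        refine (norm_add_le _ _).trans ?_
        rw [norm_mul, Complex.norm_I, Complex.norm_real, Complex.norm_real, Real.norm_eq_abs,
          Real.norm_eq_abs, abs_of_pos (by linarith : 0 < T)]
        linarith
      have hq : ‖1 - ((x : ℂ) + T * Complex.I) ^ 2‖ ≤ 5 * T ^ 2 := by
        refine (norm_sub_le _ _).trans ?_
        rw [norm_one, norm_pow]
        nlinarith [norm_nonneg ((x : ℂ) + T * Complex.I)]
      have hexp : ‖Complex.exp (z * (x + T * Complex.I) * Complex.I)‖ = (Real.exp (z * T))⁻¹ := by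
        rw [Complex.norm_exp, ← Real.exp_neg]
        congr 1
        simp
      simp only [psiKernel]
      rw [norm_mul, hexp, Complex.norm_cpow_real, ← div_eq_mul_inv, ← mul_div_assoc]
      gcongr
      calc _ ≤ (5 * T ^ 2) ^ (3 / 2 : ℝ) := Real.rpow_le_rpow (norm_nonneg _) hq (by norm_num)
        _ ≤ (5 * T ^ 2) ^ (2 : ℝ) :=
          Real.rpow_le_rpow_of_exponent_le (by nlinarith) (by norm_num)
        _ = 25 * T ^ 4 := by
          rw [Real.rpow_two]
          ring
  refine squeeze_zero_norm' (eventually_atTop.2 ⟨1, hb⟩) ?_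
  simpa using ((isLittleO_pow_exp_pos_mul_atTop 4 hz).tendsto_div_nhds_zero).const_mul 50

/-- Cauchy's theorem on the rectangle `[-1, 1] × [0, T]`. -/
lemma integral_psiKernel_rect (z T : ℝ) :
    Psi z = (∫ x in (-1 : ℝ)..1, psiKernel z (x + T * Complex.I)).re
      + 2 * (∫ y in (0 : ℝ)..T, psiKernel z (((1 : ℝ) : ℂ) + y * Complex.I)).im := by
  have h := Complex.integral_boundary_rect_eq_zero_of_continuousOn_of_differentiableOn
    (psiKernel z) (-1 : ℂ) (1 + T * Complex.I) ?_ ?_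
  · simp only [Complex.neg_re, Complex.one_re, Complex.neg_im, Complex.one_im, neg_zero,
      Complex.add_re, Complex.add_im, Complex.mul_re, Complex.mul_im, Complex.ofReal_re,
      Complex.ofReal_im, Complex.I_re, Complex.I_im, mul_zero, mul_one, sub_zero, zero_mul,
      add_zero, zero_add, Complex.ofReal_zero, psiKernel_left, smul_eq_mul] at h
    have hconj : ∫ y in (0 : ℝ)..T, (starRingEnd ℂ) (psiKernel z (((1 : ℝ) : ℂ) + y * Complex.I))
        = (starRingEnd ℂ) (∫ y in (0 : ℝ)..T, psiKernel z (((1 : ℝ) : ℂ) + y * Complex.I)) := by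
      simp only [intervalIntegral, integral_conj, map_sub]
    rw [hconj] at h
    have hre := congrArg Complex.re h
    simp only [Complex.add_re, Complex.sub_re, Complex.mul_re, Complex.I_re, Complex.I_im,
      Complex.conj_re, Complex.conj_im, Complex.zero_re] at hre
    rw [integral_psiKernel_re] at hre
    linarith
  · intro u hu
    rw [Complex.mem_reProdIm] at hu
    have := hu.1
    simp at this
    exact (continuousAt_psiKernel z this.1 this.2).continuousWithinAt
  · intro u hu
    rw [Complex.mem_reProdIm] at hu
    have := hu.1
    simp at this
    exact (differentiableAt_psiKernel z this.1 this.2).differentiableWithinAt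

lemma ofReal_mul_cpow {y : ℝ} (hy : 0 < y) {w : ℂ} (hw : w ≠ 0) (s : ℝ) :
    ((y : ℂ) * w) ^ (s : ℂ) = ((y ^ s : ℝ) : ℂ) * w ^ (s : ℂ) := by
  have hy' : (y : ℂ) ≠ 0 := Complex.ofReal_ne_zero.2 hy.ne'
  rw [Complex.ofReal_cpow hy.le, Complex.cpow_def_of_ne_zero (mul_ne_zero hy' hw),
    Complex.cpow_def_of_ne_zero hy', Complex.cpow_def_of_ne_zero hw, ← Complex.exp_add,
    Complex.log_ofReal_mul hy hw, Complex.ofReal_log hy.le, add_mul]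

lemma ofReal_sub_two_I_ne_zero (y : ℝ) : (y : ℂ) - 2 * Complex.I ≠ 0 := by
  intro h
  have := congrArg Complex.im h
  simp at this

/-- On the side above `1`, where `1 - u² = y (y - 2i)`, the kernel becomes the Laplace integrand. -/
lemma psiKernel_right (z : ℝ) {y : ℝ} (hy : 0 < y) :
    psiKernel z (((1 : ℝ) : ℂ) + y * Complex.I) = Complex.exp ((z : ℝ) * Complex.I) *
      (((y ^ (3 / 2 : ℝ) * Real.exp (-(z * y)) : ℝ) : ℂ) *
        ((y : ℂ) - 2 * Complex.I) ^ ((3 / 2 : ℝ) : ℂ)) := by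
  have h1 : 1 - (((1 : ℝ) : ℂ) + y * Complex.I) ^ 2 = y * ((y : ℂ) - 2 * Complex.I) := by
    have := Complex.I_sq
    push_cast
    linear_combination (-(y : ℂ) ^ 2) * this
  have h2 : (z * (((1 : ℝ) : ℂ) + y * Complex.I) * Complex.I : ℂ)
      = z * Complex.I + ((-(z * y) : ℝ) : ℂ) := by
    have := Complex.I_sq
    push_cast
    linear_combination (z * y : ℂ) * this
  simp only [psiKernel]
  rw [h1, h2, Complex.exp_add, ofReal_mul_cpow hy (ofReal_sub_two_I_ne_zero y),
    ← Complex.ofReal_exp, Complex.ofReal_mul]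
  ring

/-! ### Watson's lemma and the asymptotic expansion of `Psi` -/

/-- The Taylor coefficients at `0` of `y ↦ (y - 2i)^s`, through the recursion that the derivative
`s (y - 2i)^(s - 1)` forces on them. -/
noncomputable def taylorCoeff : ℕ → ℝ → ℂ
  | 0, s => (-(2 * Complex.I)) ^ (s : ℂ)
  | k + 1, s => (s / (k + 1) : ℂ) * taylorCoeff k (s - 1)

/-- The Taylor remainder of `(y - 2i)^s` on the whole half-line. The exponent drops by one at each
differentiation, so the factor `(1 + y)²` that bounds `(y - 2i)^s` for `s ≤ 2` suffices for all
orders. -/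
lemma norm_taylor_remainder_le (n : ℕ) : ∀ s : ℝ, s ≤ 2 → ∃ C : ℝ, 0 ≤ C ∧ ∀ y : ℝ, 0 ≤ y →
    ‖((y : ℂ) - 2 * Complex.I) ^ (s : ℂ) - ∑ k ∈ Finset.range n, taylorCoeff k s * (y : ℂ) ^ k‖
      ≤ C * (y ^ n * (1 + y) ^ 2) := by
  induction n with
  | zero =>
    intro s hs
    refine ⟨4, by norm_num, fun y hy => ?_⟩
    simp only [Finset.range_zero, Finset.sum_empty, sub_zero, pow_zero, one_mul]
    have h1 : 1 ≤ ‖(y : ℂ) - 2 * Complex.I‖ := by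
      have := Complex.abs_im_le_norm ((y : ℂ) - 2 * Complex.I)
      simp at this
      linarith
    have h2 : ‖(y : ℂ) - 2 * Complex.I‖ ≤ y + 2 := by
      refine (norm_sub_le _ _).trans ?_
      simp [abs_of_nonneg hy]
    rw [Complex.norm_cpow_real]
    calc _ ≤ ‖(y : ℂ) - 2 * Complex.I‖ ^ (2 : ℝ) := Real.rpow_le_rpow_of_exponent_le h1 hs
      _ ≤ (y + 2) ^ 2 := by
        rw [Real.rpow_two]
        gcongr
      _ ≤ 4 * (1 + y) ^ 2 := by nlinarith
  | succ n ih =>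
    intro s hs
    obtain ⟨C, hC, h⟩ := ih (s - 1) (by linarith)
    refine ⟨|s| * C, by positivity, fun Y hY => ?_⟩
    let E : ℝ → ℂ := fun y => ((y : ℂ) - 2 * Complex.I) ^ (s : ℂ)
      - ∑ k ∈ Finset.range (n + 1), taylorCoeff k s * (y : ℂ) ^ k
    have hder : ∀ y : ℝ, HasDerivAt E ((s : ℂ) * (((y : ℂ) - 2 * Complex.I) ^ ((s - 1 : ℝ) : ℂ)
        - ∑ k ∈ Finset.range n, taylorCoeff k (s - 1) * (y : ℂ) ^ k)) y := by
      intro y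
      have hy : HasDerivAt (fun y : ℝ => (y : ℂ)) 1 y := Complex.ofRealCLM.hasDerivAt
      have h1 : HasDerivAt (fun y : ℝ => ((y : ℂ) - 2 * Complex.I) ^ (s : ℂ))
          ((s : ℂ) * ((y : ℂ) - 2 * Complex.I) ^ ((s : ℂ) - 1)) y := by
        have h0 : HasDerivAt (fun w : ℂ => (w - 2 * Complex.I) ^ (s : ℂ))
            ((s : ℂ) * ((y : ℂ) - 2 * Complex.I) ^ ((s : ℂ) - 1) * 1) (y : ℂ) :=
          ((hasDerivAt_id (y : ℂ)).sub_const _).cpow_const (Or.inr (by simp))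
        simpa using h0.comp_ofReal
      have h2 : HasDerivAt (fun y : ℝ => ∑ k ∈ Finset.range (n + 1), taylorCoeff k s * (y : ℂ) ^ k)
          (∑ k ∈ Finset.range (n + 1), taylorCoeff k s * (k * (y : ℂ) ^ (k - 1))) y := by
        refine HasDerivAt.fun_sum fun k _ => ?_
        have := (hy.pow k).const_mul (taylorCoeff k s)
        simpa using this
      refine (h1.sub h2).congr_deriv ?_
      rw [Finset.sum_range_succ', mul_sub, Finset.mul_sum]
      simp only [Nat.cast_zero, zero_mul, mul_zero, add_zero, Nat.add_sub_cancel]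
      congr 1
      · push_cast
        rfl
      · refine Finset.sum_congr rfl fun k _ => ?_
        have hk : (k + 1 : ℂ) ≠ 0 := Nat.cast_add_one_ne_zero k
        simp only [taylorCoeff]
        push_cast
        field_simp
    have hE0 : E 0 = 0 := by
      simp only [E]
      rw [Finset.sum_range_succ']
      simp [taylorCoeff]
    have hbound := Convex.norm_image_sub_le_of_norm_hasDerivWithin_le (f := E) (s := Set.Icc 0 Y)
      (x := 0) (y := Y) (C := |s| * (C * (Y ^ n * (1 + Y) ^ 2)))
      (fun y _ => (hder y).hasDerivWithinAt) ?_ (convex_Icc _ _) (by simp [hY]) (by simp [hY])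
    · rw [hE0, sub_zero, sub_zero, Real.norm_of_nonneg hY] at hbound
      refine hbound.trans (le_of_eq ?_)
      ring
    · intro y hy
      rw [norm_mul, Complex.norm_real, Real.norm_eq_abs]
      have h0 := hy.1
      have h1 := hy.2
      refine mul_le_mul_of_nonneg_left ((h y hy.1).trans ?_) (abs_nonneg _)
      gcongr

lemma integrableOn_rpow_mul_exp {s z : ℝ} (hs : -1 < s) (hz : 0 < z) :
    IntegrableOn (fun y : ℝ => y ^ s * Real.exp (-(z * y))) (Set.Ioi 0) := by
  simpa [neg_mul] using integrableOn_rpow_mul_exp_neg_mul_rpow hs one_pos hz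

lemma integral_rpow_mul_exp {s z : ℝ} (hs : -1 < s) (hz : 0 < z) :
    ∫ y in Set.Ioi (0 : ℝ), y ^ s * Real.exp (-(z * y)) = Real.Gamma (s + 1) * z ^ (-(s + 1)) := by
  have h := Real.integral_rpow_mul_exp_neg_mul_Ioi (a := s + 1) (by linarith) hz
  rw [add_sub_cancel_right] at h
  rw [h, one_div, Real.inv_rpow hz.le, Real.rpow_neg hz.le, mul_comm]

/-- A weight that is `O(yⁿ (1 + y)²)` contributes `O(z^{-5/2-n})` to the Laplace integral with
kernel `y^{3/2} e^{-zy}`. -/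
lemma laplace_bound (n : ℕ) {C : ℝ} (hC : 0 ≤ C) {f : ℝ → ℂ} (hf : Continuous f)
    (hb : ∀ y : ℝ, 0 ≤ y → ‖f y‖ ≤ C * (y ^ n * (1 + y) ^ 2)) {z : ℝ} (hz : 1 ≤ z) :
    IntegrableOn (fun y : ℝ => ((y ^ (3 / 2 : ℝ) * Real.exp (-(z * y)) : ℝ) : ℂ) * f y)
      (Set.Ioi 0) ∧
    ‖∫ y in Set.Ioi (0 : ℝ), ((y ^ (3 / 2 : ℝ) * Real.exp (-(z * y)) : ℝ) : ℂ) * f y‖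
      ≤ 2 * C * (Real.Gamma (n + 5 / 2) + Real.Gamma (n + 9 / 2)) * z ^ (-(5 / 2 : ℝ) - n) := by
  have hz0 : 0 < z := by linarith
  have hn : (0 : ℝ) ≤ n := n.cast_nonneg
  have hi1 := integrableOn_rpow_mul_exp (s := n + 3 / 2) (by linarith) hz0
  have hi2 := integrableOn_rpow_mul_exp (s := n + 7 / 2) (by linarith) hz0
  have hmaj := (hi1.add hi2).const_mul (2 * C)
  have hle : ∀ y ∈ Set.Ioi (0 : ℝ),
      ‖((y ^ (3 / 2 : ℝ) * Real.exp (-(z * y)) : ℝ) : ℂ) * f y‖ ≤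
      2 * C * (y ^ ((n : ℝ) + 3 / 2) * Real.exp (-(z * y))
        + y ^ ((n : ℝ) + 7 / 2) * Real.exp (-(z * y))) := by
    intro y hy
    have hy0 : 0 < y := hy
    rw [norm_mul, Complex.norm_real, Real.norm_of_nonneg (by positivity)]
    have e1 : y ^ ((n : ℝ) + 3 / 2) = y ^ n * y ^ (3 / 2 : ℝ) := by
      rw [Real.rpow_add hy0, Real.rpow_natCast]
    have e2 : y ^ ((n : ℝ) + 7 / 2) = y ^ n * y ^ 2 * y ^ (3 / 2 : ℝ) := by
      rw [show (n : ℝ) + 7 / 2 = n + 2 + 3 / 2 by ring, Real.rpow_add hy0, Real.rpow_add hy0,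
        Real.rpow_natCast, Real.rpow_two]
    rw [e1, e2]
    calc _ ≤ y ^ (3 / 2 : ℝ) * Real.exp (-(z * y)) * (C * (y ^ n * (2 * (1 + y ^ 2)))) := by
          gcongr
          refine (hb y hy0.le).trans ?_
          gcongr
          nlinarith [sq_nonneg (1 - y)]
      _ = _ := by ring
  have hmeas : AEStronglyMeasurable
      (fun y : ℝ => ((y ^ (3 / 2 : ℝ) * Real.exp (-(z * y)) : ℝ) : ℂ) * f y)
      (volume.restrict (Set.Ioi 0)) := by
    refine Measurable.aestronglyMeasurable (Measurable.mul ?_ hf.measurable)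
    fun_prop
  have hae := (ae_restrict_iff' measurableSet_Ioi).2
    (Eventually.of_forall (f := ae volume) hle)
  refine ⟨Integrable.mono' hmaj hmeas hae, ?_⟩
  refine (norm_integral_le_of_norm_le hmaj hae).trans ?_
  have h_int : ∫ y in Set.Ioi (0 : ℝ), 2 * C * (y ^ ((n : ℝ) + 3 / 2) * Real.exp (-(z * y))
        + y ^ ((n : ℝ) + 7 / 2) * Real.exp (-(z * y)))
      = 2 * C * (Real.Gamma (n + 5 / 2) * z ^ (-(5 / 2 : ℝ) - n)
        + Real.Gamma (n + 9 / 2) * z ^ (-(9 / 2 : ℝ) - n)) := by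
    rw [integral_const_mul, integral_add hi1 hi2, integral_rpow_mul_exp (by linarith) hz0,
      integral_rpow_mul_exp (by linarith) hz0]
    congr 3 <;> congr 1 <;> ring
  refine (le_of_eq h_int).trans ?_
  have hzz : z ^ (-(9 / 2 : ℝ) - n) ≤ z ^ (-(5 / 2 : ℝ) - n) :=
    Real.rpow_le_rpow_of_exponent_le hz (by linarith)
  have hG := (Real.Gamma_pos_of_pos (by positivity : (0 : ℝ) < n + 9 / 2)).le
  nlinarith [mul_nonneg hC (mul_nonneg hG (sub_nonneg.2 hzz))]

/-- The Laplace integral in Hankel's representation `Ψ(z) = 2 Im (e^{iz} H(z))`. -/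
noncomputable def hankelIntegral (z : ℝ) : ℂ :=
  ∫ y in Set.Ioi (0 : ℝ), ((y ^ (3 / 2 : ℝ) * Real.exp (-(z * y)) : ℝ) : ℂ) *
    ((y : ℂ) - 2 * Complex.I) ^ ((3 / 2 : ℝ) : ℂ)

lemma continuous_ofReal_sub_cpow (s : ℝ) :
    Continuous fun y : ℝ => ((y : ℂ) - 2 * Complex.I) ^ (s : ℂ) :=
  Continuous.cpow (by fun_prop) continuous_const fun y => Or.inr (by simp)

lemma integrableOn_hankel {z : ℝ} (hz : 1 ≤ z) :
    IntegrableOn (fun y : ℝ => ((y ^ (3 / 2 : ℝ) * Real.exp (-(z * y)) : ℝ) : ℂ) *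
      ((y : ℂ) - 2 * Complex.I) ^ ((3 / 2 : ℝ) : ℂ)) (Set.Ioi 0) := by
  obtain ⟨C, hC, h⟩ := norm_taylor_remainder_le 0 (3 / 2) (by norm_num)
  refine (laplace_bound 0 hC (continuous_ofReal_sub_cpow _) (fun y hy => ?_) hz).1
  simpa using h y hy

theorem Psi_eq_hankelIntegral {z : ℝ} (hz : 1 ≤ z) :
    Psi z = 2 * (Complex.exp ((z : ℝ) * Complex.I) * hankelIntegral z).im := by
  have hz0 : 0 < z := by linarith
  have htop : Tendsto (fun T : ℝ =>
      (∫ x in (-1 : ℝ)..1, psiKernel z (x + T * Complex.I)).re) atTop (𝓝 0) := by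
    exact (Complex.continuous_re.tendsto 0).comp (tendsto_integral_psiKernel_top hz0)
  have h_int := (integrableOn_hankel hz).const_mul (Complex.exp ((z : ℝ) * Complex.I))
  have hr := intervalIntegral_tendsto_integral_Ioi 0 h_int tendsto_id
  rw [integral_const_mul] at hr
  have him := ((Complex.continuous_im.tendsto _).comp hr).const_mul 2
  have hlim := htop.add him
  rw [zero_add] at hlim
  refine tendsto_nhds_unique (tendsto_const_nhds.congr' ?_) hlim
  filter_upwards [eventually_ge_atTop 0] with T hT
  rw [integral_psiKernel_rect z T]
  congr 3
  refine intervalIntegral.integral_congr_ae (Eventually.of_forall fun y hy => ?_)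
  rw [Set.uIoc_of_le hT] at hy
  exact psiKernel_right z hy.1

/-- The coefficients of the expansion `Ψ(z) ~ ∑ₖ Re (aₖ e^{iz}) z^{-5/2-k}`. -/
noncomputable def psiCoeff (k : ℕ) : ℂ :=
  -(2 * Complex.I) * (taylorCoeff k (3 / 2) * (Real.Gamma (k + 5 / 2) : ℂ))

theorem Psi_expansion (n : ℕ) : ∃ C : ℝ, 0 ≤ C ∧ ∀ z : ℝ, 1 ≤ z →
    |Psi z - ∑ k ∈ Finset.range n,
      (psiCoeff k * Complex.exp ((z : ℝ) * Complex.I)).re * z ^ (-(5 / 2 : ℝ) - k)|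
      ≤ C * z ^ (-(5 / 2 : ℝ) - n) := by
  obtain ⟨C, hC, h⟩ := norm_taylor_remainder_le n (3 / 2) (by norm_num)
  have hn : (0 : ℝ) ≤ n := n.cast_nonneg
  have hG1 := (Real.Gamma_pos_of_pos (by positivity : (0 : ℝ) < n + 5 / 2)).le
  have hG2 := (Real.Gamma_pos_of_pos (by positivity : (0 : ℝ) < n + 9 / 2)).le
  refine ⟨2 * (2 * C * (Real.Gamma (n + 5 / 2) + Real.Gamma (n + 9 / 2))), by positivity,
    fun z hz => ?_⟩
  have hz0 : 0 < z := by linarith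
  have hcont : Continuous fun y : ℝ => ((y : ℂ) - 2 * Complex.I) ^ ((3 / 2 : ℝ) : ℂ)
      - ∑ k ∈ Finset.range n, taylorCoeff k (3 / 2) * (y : ℂ) ^ k :=
    (continuous_ofReal_sub_cpow _).sub (by fun_prop)
  have hbd := (laplace_bound n hC hcont h hz).2
  have hterm : ∀ k : ℕ, IntegrableOn (fun y : ℝ =>
        ((y ^ (3 / 2 : ℝ) * Real.exp (-(z * y)) : ℝ) : ℂ) * (taylorCoeff k (3 / 2) * (y : ℂ) ^ k))
        (Set.Ioi 0) ∧
      ∫ y in Set.Ioi (0 : ℝ), ((y ^ (3 / 2 : ℝ) * Real.exp (-(z * y)) : ℝ) : ℂ) *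
        (taylorCoeff k (3 / 2) * (y : ℂ) ^ k)
      = taylorCoeff k (3 / 2) * ((Real.Gamma (k + 5 / 2) : ℝ) : ℂ)
        * ((z ^ (-(5 / 2 : ℝ) - k) : ℝ) : ℂ) := by
    intro k
    have hk : (0 : ℝ) ≤ k := k.cast_nonneg
    have hfun : Set.EqOn (fun y : ℝ => ((y ^ (3 / 2 : ℝ) * Real.exp (-(z * y)) : ℝ) : ℂ) *
        (taylorCoeff k (3 / 2) * (y : ℂ) ^ k)) (fun y : ℝ => taylorCoeff k (3 / 2) *
          ((y ^ ((k : ℝ) + 3 / 2) * Real.exp (-(z * y)) : ℝ) : ℂ)) (Set.Ioi 0) := by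
      intro y hy
      have hy0 : 0 < y := hy
      simp only
      rw [Real.rpow_add hy0, Real.rpow_natCast]
      push_cast
      ring
    constructor
    · refine IntegrableOn.congr_fun ?_ hfun.symm measurableSet_Ioi
      exact ((integrableOn_rpow_mul_exp (by linarith) hz0).ofReal).const_mul _
    · rw [setIntegral_congr_fun measurableSet_Ioi hfun, integral_const_mul, integral_complex_ofReal,
        integral_rpow_mul_exp (by linarith) hz0]
      push_cast
      rw [mul_assoc]
      congr 4 <;> ring
  have hsplit : ∫ y in Set.Ioi (0 : ℝ), ((y ^ (3 / 2 : ℝ) * Real.exp (-(z * y)) : ℝ) : ℂ) *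
      (((y : ℂ) - 2 * Complex.I) ^ ((3 / 2 : ℝ) : ℂ)
        - ∑ k ∈ Finset.range n, taylorCoeff k (3 / 2) * (y : ℂ) ^ k)
      = hankelIntegral z - ∑ k ∈ Finset.range n, taylorCoeff k (3 / 2)
        * ((Real.Gamma (k + 5 / 2) : ℝ) : ℂ) * ((z ^ (-(5 / 2 : ℝ) - k) : ℝ) : ℂ) := by
    simp only [mul_sub, Finset.mul_sum]
    rw [integral_sub (integrableOn_hankel hz) (integrable_finsetSum _ fun k _ => (hterm k).1),
      integral_finsetSum _ fun k _ => (hterm k).1]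
    congr 1
    exact Finset.sum_congr rfl fun k _ => (hterm k).2
  rw [hsplit] at hbd
  have hident : Psi z - ∑ k ∈ Finset.range n,
      (psiCoeff k * Complex.exp ((z : ℝ) * Complex.I)).re * z ^ (-(5 / 2 : ℝ) - k)
      = 2 * (Complex.exp ((z : ℝ) * Complex.I) * (hankelIntegral z - ∑ k ∈ Finset.range n,
        taylorCoeff k (3 / 2) * ((Real.Gamma (k + 5 / 2) : ℝ) : ℂ)
          * ((z ^ (-(5 / 2 : ℝ) - k) : ℝ) : ℂ))).im := by
    rw [Psi_eq_hankelIntegral hz, mul_sub, Complex.sub_im, mul_sub, Finset.mul_sum, Complex.im_sum,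
      Finset.mul_sum]
    congr 1
    refine Finset.sum_congr rfl fun k _ => ?_
    have : Complex.exp ((z : ℝ) * Complex.I) * (taylorCoeff k (3 / 2)
        * ((Real.Gamma (k + 5 / 2) : ℝ) : ℂ) * ((z ^ (-(5 / 2 : ℝ) - k) : ℝ) : ℂ))
        = ((z ^ (-(5 / 2 : ℝ) - k) : ℝ) : ℂ) * (Complex.exp ((z : ℝ) * Complex.I) *
          (taylorCoeff k (3 / 2) * ((Real.Gamma (k + 5 / 2) : ℝ) : ℂ))) := by ring
    rw [this, Complex.im_ofReal_mul, psiCoeff]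
    simp
    ring
  rw [hident, abs_mul, abs_two, mul_assoc 2]
  refine mul_le_mul_of_nonneg_left ((Complex.abs_im_le_norm _).trans ?_) two_pos.le
  rw [norm_mul, Complex.norm_exp_ofReal_mul_I, one_mul]
  exact hbd

/-- The leading coefficient is `a₀ = -3 √(2π) e^{-iπ/4}`. -/
lemma psiCoeff_zero :
    psiCoeff 0 = ((-(3 * Real.sqrt 2 * Real.sqrt Real.pi) : ℝ) : ℂ)
      * Complex.exp ((-(Real.pi / 4) : ℝ) * Complex.I) := by
  have hG : Real.Gamma (((0 : ℕ) : ℝ) + 5 / 2) = 3 / 4 * Real.sqrt Real.pi := by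
    rw [Nat.cast_zero, zero_add, show (5 / 2 : ℝ) = 1 / 2 + 1 + 1 by norm_num,
      Real.Gamma_add_one (by norm_num), Real.Gamma_add_one (by norm_num), Real.Gamma_one_half_eq]
    ring
  have h2 : (2 : ℝ) ^ (3 / 2 : ℝ) = 2 * Real.sqrt 2 := by
    rw [show (3 / 2 : ℝ) = 1 + 1 / 2 by norm_num, Real.rpow_add two_pos, Real.rpow_one,
      Real.sqrt_eq_rpow]
  have hI : (-Complex.I) ^ ((3 / 2 : ℝ) : ℂ)
      = Complex.exp ((-(3 * Real.pi / 4) : ℝ) * Complex.I) := by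
    rw [Complex.cpow_def_of_ne_zero (neg_ne_zero.2 Complex.I_ne_zero), Complex.log_neg_I]
    congr 1
    push_cast
    ring
  have hb : taylorCoeff 0 (3 / 2) = ((2 * Real.sqrt 2 : ℝ) : ℂ)
      * Complex.exp ((-(3 * Real.pi / 4) : ℝ) * Complex.I) := by
    rw [taylorCoeff, show -(2 * Complex.I) = ((2 : ℝ) : ℂ) * (-Complex.I) by push_cast; ring,
      ofReal_mul_cpow two_pos (neg_ne_zero.2 Complex.I_ne_zero), h2, hI]
  have hexp : Complex.exp ((-(3 * Real.pi / 4) : ℝ) * Complex.I)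
      = -Complex.I * Complex.exp ((-(Real.pi / 4) : ℝ) * Complex.I) := by
    have : Complex.exp (-(Real.pi / 2) * Complex.I) = -Complex.I := by
      rw [neg_mul, Complex.exp_neg, Complex.exp_pi_div_two_mul_I, Complex.inv_I]
    rw [← this, ← Complex.exp_add]
    congr 1
    push_cast
    ring
  rw [psiCoeff, hG, hb, hexp]
  have := Complex.I_sq
  push_cast
  linear_combination (3 * (Real.sqrt 2 : ℂ) * (Real.sqrt Real.pi : ℂ)
    * Complex.exp (-(Real.pi / 4 : ℂ) * Complex.I)) * this

/-! ### The paraboloid cap and its Fourier transform -/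

/-- The cap `max (a - x² - y²) 0` of a paraboloid. -/
noncomputable def cap (a x y : ℝ) : ℝ := max (a - x ^ 2 - y ^ 2) 0

/-- The Fourier transform of `cap a` on `ℝ²`. -/
noncomputable def capHat (a ξ η : ℝ) : ℂ :=
  ∫ p : ℝ × ℝ, Complex.exp ((-2 * Real.pi * (p.1 * ξ + p.2 * η) : ℝ) * Complex.I) *
    (cap a p.1 p.2 : ℂ)

lemma continuous_cap (a : ℝ) : Continuous fun p : ℝ × ℝ => cap a p.1 p.2 := by
  unfold cap
  fun_prop

lemma cap_comm (a x y : ℝ) : cap a x y = cap a y x := by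
  unfold cap
  rw [sub_right_comm]

lemma cap_eq_zero_of_lt_left {a x : ℝ} (h : Real.sqrt a < |x|) (y : ℝ) : cap a x y = 0 := by
  have h1 := Real.lt_sq_of_sqrt_lt h
  rw [sq_abs] at h1
  exact max_eq_right (by nlinarith [sq_nonneg y])

lemma cap_eq_zero_of_lt_right {a y : ℝ} (h : Real.sqrt a < |y|) (x : ℝ) : cap a x y = 0 := by
  rw [cap_comm]
  exact cap_eq_zero_of_lt_left h x

lemma integral_eq_intervalIntegral_of_zero {f : ℝ → ℂ} {s : ℝ} (hs : 0 ≤ s)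
    (h : ∀ x, s < |x| → f x = 0) : ∫ x, f x = ∫ x in (-s)..s, f x := by
  rw [intervalIntegral.integral_of_le (by linarith), ← integral_Icc_eq_integral_Ioc]
  refine (setIntegral_eq_integral_of_forall_compl_eq_zero fun x hx => h x ?_).symm
  by_contra! hc
  exact hx (abs_le.1 hc)

/-- For `a < x²` the slice of the cap vanishes, and the square root of the negative number is `0`, so
the interval on the right degenerates. -/
lemma integral_cap_mul (a x : ℝ) (f : ℝ → ℂ) :
    ∫ y, f y * (cap a x y : ℂ)
      = ∫ y in (-Real.sqrt (a - x ^ 2))..Real.sqrt (a - x ^ 2), f y * (a - x ^ 2 - y ^ 2 : ℝ) := by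
  rw [integral_eq_intervalIntegral_of_zero (Real.sqrt_nonneg (a - x ^ 2))]
  · refine intervalIntegral.integral_congr_ae (Eventually.of_forall fun y hy => ?_)
    rw [Set.uIoc_of_le (by linarith [Real.sqrt_nonneg (a - x ^ 2)])] at hy
    have h1 : |y| ≤ Real.sqrt (a - x ^ 2) := abs_le.2 ⟨hy.1.le, hy.2⟩
    have hb : 0 < a - x ^ 2 := Real.sqrt_pos.1 (by linarith [hy.1, hy.2])
    have h2 : y ^ 2 ≤ a - x ^ 2 := by
      rw [← sq_abs, ← Real.sq_sqrt hb.le]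
      gcongr
    rw [cap, max_eq_left (by linarith)]
  · intro y hy
    have h1 := Real.lt_sq_of_sqrt_lt hy
    rw [sq_abs] at h1
    have : cap a x y = 0 := max_eq_right (by linarith)
    rw [this]
    simp

/-- Along each line the transform of the cap decays quadratically. -/
lemma norm_integral_exp_mul_cap_le (a x : ℝ) {κ : ℝ} (hκ : 1 ≤ |κ|) :
    ‖∫ y, Complex.exp ((κ * y : ℝ) * Complex.I) * (cap a x y : ℂ)‖
      ≤ (4 * Real.sqrt (a - x ^ 2) + 4) * (1 / κ ^ 2) := by
  rw [integral_cap_mul]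
  set s := Real.sqrt (a - x ^ 2) with hs
  have hs0 : 0 ≤ s := Real.sqrt_nonneg _
  rcases le_or_gt (a - x ^ 2) 0 with hb | hb
  · have : s = 0 := Real.sqrt_eq_zero_of_nonpos hb
    rw [this]
    simp
    positivity
  have hsq : s ^ 2 = a - x ^ 2 := Real.sq_sqrt hb.le
  have hκ0 : κ ≠ 0 := by
    rintro rfl
    simp at hκ
    linarith
  set c : ℂ := κ * Complex.I with hc
  have hc0 : c ≠ 0 := mul_ne_zero (Complex.ofReal_ne_zero.2 hκ0) Complex.I_ne_zero
  have hcn : ‖c‖ = |κ| := by simp [hc]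
  -- the antiderivative found by integrating by parts twice
  let F : ℝ → ℂ := fun y => Complex.exp (c * y) *
    ((a - x ^ 2 - y ^ 2) / c + 2 * y / c ^ 2 - 2 / c ^ 3)
  have hF : ∀ y : ℝ, HasDerivAt F
      (Complex.exp ((κ * y : ℝ) * Complex.I) * (a - x ^ 2 - y ^ 2 : ℝ)) y := by
    intro y
    have h1 : HasDerivAt (fun w : ℂ => Complex.exp (c * w) *
        ((a - x ^ 2 - w ^ 2) / c + 2 * w / c ^ 2 - 2 / c ^ 3))
        (Complex.exp (c * y) * (c * 1) * ((a - x ^ 2 - (y : ℂ) ^ 2) / c + 2 * y / c ^ 2 - 2 / c ^ 3)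
          + Complex.exp (c * y) * ((-(2 * (y : ℂ) ^ 1 * 1)) / c + 2 * 1 / c ^ 2)) (y : ℂ) := by
      refine HasDerivAt.mul ((hasDerivAt_id _).const_mul c).cexp (HasDerivAt.sub_const _ ?_)
      refine HasDerivAt.add (HasDerivAt.div_const ?_ _)
        ((HasDerivAt.const_mul 2 (hasDerivAt_id _)).div_const _)
      simpa using ((hasDerivAt_id (y : ℂ)).pow 2).const_sub ((a : ℂ) - x ^ 2)
    refine h1.comp_ofReal.congr_deriv ?_
    have : ((κ * y : ℝ) : ℂ) * Complex.I = c * y := by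
      rw [hc]
      push_cast
      ring
    rw [this]
    push_cast
    field_simp
    ring
  rw [intervalIntegral.integral_eq_sub_of_hasDerivAt (fun y _ => hF y)
    (Continuous.intervalIntegrable (by fun_prop) _ _)]
  have hend : ∀ y : ℝ, y ^ 2 = s ^ 2 → ‖F y‖ ≤ (2 * s + 2) * (1 / κ ^ 2) := by
    intro y hy
    have h0 : ((a : ℂ) - x ^ 2 - y ^ 2) = 0 := by
      have : a - x ^ 2 - y ^ 2 = 0 := by linarith
      exact_mod_cast this
    have he : ‖Complex.exp (c * y)‖ = 1 := by
      have : c * y = ((κ * y : ℝ) : ℂ) * Complex.I := by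
        rw [hc]
        push_cast
        ring
      rw [this, Complex.norm_exp_ofReal_mul_I]
    have hy' : |y| = s := by
      rw [← abs_of_nonneg hs0]
      exact (sq_eq_sq_iff_abs_eq_abs _ _).1 hy
    simp only [F]
    rw [norm_mul, he, one_mul, h0, zero_div, zero_add]
    refine (norm_sub_le _ _).trans ?_
    rw [norm_div, norm_div, norm_mul, norm_pow, norm_pow, hcn, Complex.norm_real, Real.norm_eq_abs,
      hy', Complex.norm_ofNat, sq_abs, add_mul]
    have h3 : 2 / |κ| ^ 3 ≤ 2 * (1 / κ ^ 2) := by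
      rw [← sq_abs κ, mul_one_div]
      exact div_le_div_of_nonneg_left two_pos.le (by positivity)
        (pow_le_pow_right₀ hκ (by norm_num))
    have h4 : 2 * s / κ ^ 2 = 2 * s * (1 / κ ^ 2) := by ring
    linarith
  refine (norm_sub_le _ _).trans ?_
  have e1 := hend s rfl
  have e2 := hend (-s) (by ring)
  linarith

lemma integrable_exp_mul_cap (a ξ η : ℝ) : Integrable fun p : ℝ × ℝ =>
    Complex.exp ((-2 * Real.pi * (p.1 * ξ + p.2 * η) : ℝ) * Complex.I) * (cap a p.1 p.2 : ℂ) := by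
  refine Continuous.integrable_of_hasCompactSupport ?_ ?_
  · exact Continuous.mul (by fun_prop) (Complex.continuous_ofReal.comp (continuous_cap a))
  · refine HasCompactSupport.intro
      (K := Set.Icc (-Real.sqrt a) (Real.sqrt a) ×ˢ Set.Icc (-Real.sqrt a) (Real.sqrt a))
      (isCompact_Icc.prod isCompact_Icc) fun p hp => ?_
    have h0 : cap a p.1 p.2 = 0 := by
      by_cases h1 : |p.1| ≤ Real.sqrt a
      · by_cases h2 : |p.2| ≤ Real.sqrt a
        · exact absurd ⟨abs_le.1 h1, abs_le.1 h2⟩ hp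
        · exact cap_eq_zero_of_lt_right (not_le.1 h2) _
      · exact cap_eq_zero_of_lt_left (not_le.1 h1) _
    rw [h0]
    simp

/-- The cap is radial, so its Fourier transform depends only on the length of the frequency. -/
lemma capHat_eq_radial (a ξ η : ℝ) : capHat a ξ η = capHat a (Real.sqrt (ξ ^ 2 + η ^ 2)) 0 := by
  set r := Real.sqrt (ξ ^ 2 + η ^ 2) with hr
  have key : ∀ ξ η : ℝ, capHat a ξ η = ∫ w : ℂ,
      Complex.exp ((-2 * Real.pi * (w.re * ξ + w.im * η) : ℝ) * Complex.I) *
        (cap a w.re w.im : ℂ) := by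
    intro ξ η
    exact (Complex.volume_preserving_equiv_real_prod.integral_comp
      Complex.measurableEquivRealProd.measurableEmbedding fun p : ℝ × ℝ =>
        Complex.exp ((-2 * Real.pi * (p.1 * ξ + p.2 * η) : ℝ) * Complex.I) *
          (cap a p.1 p.2 : ℂ)).symm
  rw [key, key]
  obtain ⟨θ, hξ, hη⟩ : ∃ θ : ℝ, ξ = r * Real.cos θ ∧ η = r * Real.sin θ := by
    have hn : ‖(⟨ξ, η⟩ : ℂ)‖ = r := by
      rw [Complex.norm_eq_sqrt_sq_add_sq]
    refine ⟨Complex.arg ⟨ξ, η⟩, ?_, ?_⟩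
    · rw [← hn, Complex.norm_mul_cos_arg]
    · rw [← hn, Complex.norm_mul_sin_arg]
  -- rotate the frequency onto the positive real axis
  have hrot := (rotation (Circle.exp θ)).measurePreserving.integral_comp
    (rotation (Circle.exp θ)).toHomeomorph.measurableEmbedding fun w : ℂ =>
      Complex.exp ((-2 * Real.pi * (w.re * ξ + w.im * η) : ℝ) * Complex.I) *
        (cap a w.re w.im : ℂ)
  rw [← hrot]
  refine integral_congr_ae (Eventually.of_forall fun w => ?_)
  simp only [rotation_apply, Circle.coe_exp]
  have hsc := Real.sin_sq_add_cos_sq θ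
  have hre : (Complex.exp (θ * Complex.I) * w).re = Real.cos θ * w.re - Real.sin θ * w.im := by
    rw [Complex.mul_re, Complex.exp_ofReal_mul_I_re, Complex.exp_ofReal_mul_I_im]
  have him : (Complex.exp (θ * Complex.I) * w).im = Real.cos θ * w.im + Real.sin θ * w.re := by
    rw [Complex.mul_im, Complex.exp_ofReal_mul_I_re, Complex.exp_ofReal_mul_I_im]
  rw [hre, him]
  congr 1
  · congr 3
    rw [hξ, hη]
    linear_combination (-2 * Real.pi * r * w.re) * hsc
  · congr 1
    unfold cap
    congr 1
    linear_combination (-(w.re ^ 2 + w.im ^ 2)) * hsc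

/-- The odd part of the exponential integrates to zero. -/
lemma integral_psiKernel (z : ℝ) : ∫ x in (-1 : ℝ)..1, psiKernel z x = Psi z := by
  have hsym : ∀ x ∈ Set.uIcc (-1 : ℝ) 1,
      (starRingEnd ℂ) (psiKernel z x) = psiKernel z ((-x : ℝ) : ℂ) := by
    intro x hx
    rw [Set.uIcc_of_le (by norm_num)] at hx
    have h0 : 0 ≤ 1 - x ^ 2 := by nlinarith [hx.1, hx.2]
    have h1 : ((1 : ℂ) - (x : ℂ) ^ 2) = ((1 - x ^ 2 : ℝ) : ℂ) := by push_cast; ring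
    have h2 : ((1 : ℂ) - ((-x : ℝ) : ℂ) ^ 2) = ((1 - x ^ 2 : ℝ) : ℂ) := by push_cast; ring
    simp only [psiKernel]
    rw [h1, h2, ← Complex.ofReal_cpow h0, map_mul, Complex.conj_ofReal, ← Complex.exp_conj]
    congr 2
    simp
  have hconj : (starRingEnd ℂ) (∫ x in (-1 : ℝ)..1, psiKernel z x)
      = ∫ x in (-1 : ℝ)..1, psiKernel z x := by
    have h1 : (starRingEnd ℂ) (∫ x in (-1 : ℝ)..1, psiKernel z x)
        = ∫ x in (-1 : ℝ)..1, (starRingEnd ℂ) (psiKernel z x) := by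
      simp only [intervalIntegral, integral_conj, map_sub]
    rw [h1, intervalIntegral.integral_congr hsym,
      intervalIntegral.integral_comp_neg (fun x : ℝ => psiKernel z x), neg_neg]
  rw [← integral_psiKernel_re, Complex.conj_eq_iff_re.1 hconj]

lemma integral_cap (a x : ℝ) :
    ∫ y, (cap a x y : ℂ) = ((4 / 3 * Real.sqrt (a - x ^ 2) ^ 3 : ℝ) : ℂ) := by
  have h := integral_cap_mul a x fun _ => 1
  simp only [one_mul] at h
  rw [h, intervalIntegral.integral_ofReal]
  congr 1
  set s := Real.sqrt (a - x ^ 2) with hs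
  rw [intervalIntegral.integral_sub (by simp) (Continuous.intervalIntegrable (by fun_prop) _ _),
    intervalIntegral.integral_const, integral_pow, smul_eq_mul]
  rcases le_or_gt (a - x ^ 2) 0 with hb | hb
  · have : s = 0 := Real.sqrt_eq_zero_of_nonpos hb
    rw [this]
    norm_num
  · have hsq : s ^ 2 = a - x ^ 2 := Real.sq_sqrt hb.le
    rw [← hsq]
    norm_num
    ring

theorem capHat_eq_Psi {a : ℝ} (ha : 0 < a) (ξ η : ℝ) :
    capHat a ξ η = ((4 / 3 * a ^ 2
      * Psi (2 * Real.pi * Real.sqrt a * Real.sqrt (ξ ^ 2 + η ^ 2)) : ℝ) : ℂ) := by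
  rw [capHat_eq_radial]
  set r := Real.sqrt (ξ ^ 2 + η ^ 2)
  set s := Real.sqrt a with hs
  have hs0 : 0 < s := Real.sqrt_pos.2 ha
  have hsq : s ^ 2 = a := Real.sq_sqrt ha.le
  unfold capHat
  rw [Measure.volume_eq_prod, integral_prod _ (integrable_exp_mul_cap a r 0)]
  simp only [mul_zero, add_zero, integral_const_mul, integral_cap]
  rw [integral_eq_intervalIntegral_of_zero hs0.le]
  · have hsub := intervalIntegral.smul_integral_comp_mul_left (a := -1) (b := 1)
      (fun x : ℝ => Complex.exp ((-2 * Real.pi * (x * r) : ℝ) * Complex.I)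
        * ((4 / 3 * Real.sqrt (a - x ^ 2) ^ 3 : ℝ) : ℂ)) s
    rw [mul_neg, mul_one] at hsub
    rw [← hsub]
    have hPsi : Psi (2 * Real.pi * s * r) = Psi (-(2 * Real.pi * s * r)) := by
      simp [Psi]
    rw [hPsi, Complex.ofReal_mul, ← integral_psiKernel, ← intervalIntegral.integral_const_mul,
      Complex.real_smul, ← intervalIntegral.integral_const_mul]
    refine intervalIntegral.integral_congr fun u hu => ?_
    rw [Set.uIcc_of_le (by norm_num)] at hu
    have h0 : 0 ≤ 1 - u ^ 2 := by nlinarith [hu.1, hu.2]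
    have h1 : ((1 : ℂ) - (u : ℂ) ^ 2) = ((1 - u ^ 2 : ℝ) : ℂ) := by push_cast; ring
    have h2 : Real.sqrt (a - (s * u) ^ 2) ^ 3 = s ^ 3 * (1 - u ^ 2) ^ (3 / 2 : ℝ) := by
      rw [show a - (s * u) ^ 2 = s ^ 2 * (1 - u ^ 2) by rw [mul_pow, hsq]; ring,
        Real.sqrt_mul (sq_nonneg s), Real.sqrt_sq hs0.le, mul_pow, Real.sqrt_eq_rpow (1 - u ^ 2),
        ← Real.rpow_natCast ((1 - u ^ 2) ^ (1 / 2 : ℝ)), ← Real.rpow_mul h0]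
      norm_num
    simp only [psiKernel]
    rw [h1, ← Complex.ofReal_cpow h0, h2, ← hsq]
    have h3 : (((-(2 * Real.pi * s * r) : ℝ) : ℂ) * u * Complex.I)
        = ((-2 * Real.pi * (s * u * r) : ℝ) : ℂ) * Complex.I := by
      push_cast
      ring
    rw [h3]
    push_cast
    ring
  · intro x hx
    have h1 := Real.lt_sq_of_sqrt_lt hx
    rw [sq_abs] at h1
    rw [Real.sqrt_eq_zero_of_nonpos (by linarith : a - x ^ 2 ≤ 0)]
    simp

/-! ### Poisson summation for the cap -/

lemma tsum_int_eq_tsum_fourier_of_bounded_support {f : ℝ → ℂ} (hc : Continuous f) {M : ℝ}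
    (hM : ∀ x, M < |x| → f x = 0) (hs : Summable fun n : ℤ => 𝓕 f n) :
    ∑' n : ℤ, f n = ∑' n : ℤ, 𝓕 f n := by
  have hO : f =O[cocompact ℝ] fun x : ℝ => |x| ^ (-2 : ℝ) := by
    refine IsBigO.of_bound 1 ?_
    filter_upwards [(tendsto_norm_cocompact_atTop (E := ℝ)).eventually_gt_atTop M] with x hx
    rw [hM x hx, norm_zero]
    positivity
  simpa using Real.tsum_eq_tsum_fourier_of_rpow_decay_of_summable hc one_lt_two hO hs 0

/-- The Fourier transform of `cap a` in the second variable alone. -/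
noncomputable def sliceHat (a x η : ℝ) : ℂ :=
  ∫ y, Complex.exp ((-2 * Real.pi * (y * η) : ℝ) * Complex.I) * (cap a x y : ℂ)

lemma fourier_cap (a x η : ℝ) : 𝓕 (fun y : ℝ => (cap a x y : ℂ)) η = sliceHat a x η := by
  rw [Real.fourier_real_eq_integral_exp_smul, sliceHat]
  simp only [smul_eq_mul, mul_assoc]

lemma sliceHat_eq_zero {a x : ℝ} (hx : Real.sqrt a < |x|) (η : ℝ) : sliceHat a x η = 0 := by
  simp [sliceHat, cap_eq_zero_of_lt_left hx]

lemma continuous_sliceHat (a η : ℝ) : Continuous fun x : ℝ => sliceHat a x η := by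
  have h : ∀ x : ℝ, sliceHat a x η = ∫ y in Set.Icc (-Real.sqrt a) (Real.sqrt a),
      Complex.exp ((-2 * Real.pi * (y * η) : ℝ) * Complex.I) * (cap a x y : ℂ) := by
    intro x
    refine (setIntegral_eq_integral_of_forall_compl_eq_zero fun y hy => ?_).symm
    have : Real.sqrt a < |y| := by
      by_contra! hc
      exact hy (abs_le.1 hc)
    rw [cap_eq_zero_of_lt_right this]
    simp
  simp_rw [h]
  refine continuous_parametric_integral_of_continuous ?_ isCompact_Icc
  exact Continuous.mul (by fun_prop) (Complex.continuous_ofReal.comp (continuous_cap a))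

lemma fourier_sliceHat (a ξ η : ℝ) : 𝓕 (fun x : ℝ => sliceHat a x η) ξ = capHat a ξ η := by
  rw [Real.fourier_real_eq_integral_exp_smul, capHat, Measure.volume_eq_prod,
    integral_prod _ (integrable_exp_mul_cap a ξ η)]
  refine integral_congr_ae (Eventually.of_forall fun x => ?_)
  simp only [sliceHat, smul_eq_mul]
  rw [← integral_const_mul]
  refine integral_congr_ae (Eventually.of_forall fun y => ?_)
  simp only
  rw [← mul_assoc, ← Complex.exp_add]
  congr 2
  push_cast
  ring

lemma summable_sliceHat (a x : ℝ) : Summable fun k : ℤ => sliceHat a x k := by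
  have hs : Summable fun k : ℤ => (4 * Real.sqrt (a - x ^ 2) + 4) * (1 / (k : ℝ) ^ 2) :=
    (Real.summable_one_div_int_pow.2 one_lt_two).mul_left _
  refine Summable.of_norm_bounded_eventually hs ?_
  filter_upwards [(Set.finite_singleton (0 : ℤ)).compl_mem_cofinite] with k hk
  have hk1 : (1 : ℝ) ≤ |(k : ℝ)| := by exact_mod_cast Int.one_le_abs hk
  have hpi : |(-2 * Real.pi * k : ℝ)| = 2 * Real.pi * |(k : ℝ)| := by
    rw [abs_mul, abs_mul, abs_neg, abs_two, abs_of_pos Real.pi_pos]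
  have hge : |(k : ℝ)| ≤ |(-2 * Real.pi * k : ℝ)| := by
    rw [hpi]
    nlinarith [Real.pi_gt_three]
  have h := norm_integral_exp_mul_cap_le a x (hk1.trans hge)
  have heq : sliceHat a x k
      = ∫ y, Complex.exp ((-2 * Real.pi * k * y : ℝ) * Complex.I) * (cap a x y : ℂ) := by
    refine integral_congr_ae (Eventually.of_forall fun y => ?_)
    simp only
    congr 4
    ring
  rw [heq]
  refine h.trans (mul_le_mul_of_nonneg_left ?_ (by positivity))
  have hk2 : (0 : ℝ) < (k : ℝ) ^ 2 := by
    rw [← sq_abs]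
    positivity
  exact one_div_le_one_div_of_le hk2 (sq_le_sq.2 hge)

/-- Two-dimensional Poisson summation for the cap, one variable at a time. -/
theorem tsum_cap_eq_tsum_capHat {a : ℝ}
    (hs : Summable fun k : ℤ × ℤ => capHat a k.1 k.2) :
    ∑' n : ℤ × ℤ, (cap a n.1 n.2 : ℂ) = ∑' k : ℤ × ℤ, capHat a k.1 k.2 := by
  obtain ⟨M, hM⟩ := exists_nat_ge (Real.sqrt a)
  set F : Finset ℤ := Finset.Icc (-(M : ℤ)) M with hF
  have hout : ∀ n : ℤ, n ∉ F → Real.sqrt a < |(n : ℝ)| := by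
    intro n hn
    refine hM.trans_lt ?_
    by_contra! hc
    have hc' : |n| ≤ (M : ℤ) := by exact_mod_cast hc
    exact hn (Finset.mem_Icc.2 (abs_le.1 hc'))
  have hsum : Summable fun n : ℤ × ℤ => (cap a n.1 n.2 : ℂ) := by
    refine summable_of_ne_finset_zero (s := F ×ˢ F) fun n hn => ?_
    have h0 : cap a n.1 n.2 = 0 := by
      by_cases h1 : n.1 ∈ F
      · by_cases h2 : n.2 ∈ F
        · exact absurd (Finset.mem_product.2 ⟨h1, h2⟩) hn
        · exact cap_eq_zero_of_lt_right (hout _ h2) _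
      · exact cap_eq_zero_of_lt_left (hout _ h1) _
    rw [h0, Complex.ofReal_zero]
  have hinner : ∀ x : ℝ, ∑' m : ℤ, (cap a x m : ℂ) = ∑' k : ℤ, sliceHat a x k := by
    intro x
    have h := tsum_int_eq_tsum_fourier_of_bounded_support (f := fun y : ℝ => (cap a x y : ℂ))
      (Complex.continuous_ofReal.comp ((continuous_cap a).comp (by fun_prop : Continuous
        fun y : ℝ => (x, y)))) (M := Real.sqrt a)
      (fun y hy => by rw [cap_eq_zero_of_lt_right hy, Complex.ofReal_zero]) ?_
    · simpa only [fourier_cap] using h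
    · simpa only [fourier_cap] using summable_sliceHat a x
  have hs' : Summable fun k : ℤ × ℤ => capHat a k.2 k.1 := (Equiv.prodComm ℤ ℤ).summable_iff.2 hs
  have houter : ∀ k : ℤ, ∑' n : ℤ, sliceHat a n k = ∑' j : ℤ, capHat a j k := by
    intro k
    have h := tsum_int_eq_tsum_fourier_of_bounded_support (f := fun x : ℝ => sliceHat a x k)
      (continuous_sliceHat a k) (M := Real.sqrt a) (fun x hx => sliceHat_eq_zero hx _) ?_
    · simpa only [fourier_sliceHat] using h
    · simpa only [fourier_sliceHat] using hs'.prod_factor k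
  calc ∑' n : ℤ × ℤ, (cap a n.1 n.2 : ℂ)
      = ∑' n : ℤ, ∑' k : ℤ, sliceHat a n k := by
        rw [hsum.tsum_prod]
        exact tsum_congr fun n => hinner n
    _ = ∑ n ∈ F, ∑' k : ℤ, sliceHat a n k := by
        refine tsum_eq_sum fun n hn => ?_
        simp [sliceHat_eq_zero (hout n hn)]
    _ = ∑' k : ℤ, ∑ n ∈ F, sliceHat a n k :=
        (Summable.tsum_finsetSum (f := fun n k : ℤ => sliceHat a n k)
          fun n _ => summable_sliceHat a n).symm
    _ = ∑' k : ℤ, ∑' n : ℤ, sliceHat a n k := by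
        refine tsum_congr fun k => (tsum_eq_sum fun n hn => ?_).symm
        exact sliceHat_eq_zero (hout n hn) _
    _ = ∑' k : ℤ, ∑' j : ℤ, capHat a j k := tsum_congr houter
    _ = ∑' k : ℤ × ℤ, capHat a k.2 k.1 := (hs'.tsum_prod).symm
    _ = ∑' k : ℤ × ℤ, capHat a k.1 k.2 :=
        (Equiv.prodComm ℤ ℤ).tsum_eq fun k : ℤ × ℤ => capHat a k.1 k.2

/-! ### The average error as a series over the dual lattice -/

lemma eNorm_sq (n : ℤ × ℤ) : eNorm n ^ 2 = (n.1 : ℝ) ^ 2 + (n.2 : ℝ) ^ 2 :=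
  Real.sq_sqrt (by positivity)

lemma mem_diskPoints_iff {t : ℝ} (ht : 0 ≤ t) (n : ℤ × ℤ) :
    n ∈ diskPoints t ↔ (2 * Real.pi * eNorm n) ^ 2 ≤ t := by
  have h0 : 0 ≤ 2 * Real.pi * eNorm n :=
    mul_nonneg (by positivity) (Real.sqrt_nonneg _)
  change eNorm n ≤ _ ↔ _
  rw [le_div_iff₀ (by positivity), mul_comm, Real.le_sqrt h0 ht]

lemma integral_step {c : ℝ} (hc : 0 ≤ c) (R : ℝ) :
    IntervalIntegrable (fun t : ℝ => if c ≤ t then (1 : ℝ) else 0) volume 0 R ∧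
    ∫ t in (0 : ℝ)..R, (if c ≤ t then (1 : ℝ) else 0) = max (R - c) 0 := by
  have hi : IntervalIntegrable (fun t : ℝ => if c ≤ t then (1 : ℝ) else 0) volume 0 R := by
    refine Monotone.intervalIntegrable fun s t hst => ?_
    split_ifs with h1 h2
    · exact le_rfl
    · exact absurd (h1.trans hst) h2
    · exact zero_le_one
    · exact le_rfl
  refine ⟨hi, ?_⟩
  -- the step includes its left end, so it is the right derivative of `max (t - c) 0` everywhere
  rw [intervalIntegral.integral_eq_sub_of_hasDeriv_right (f := fun t => max (t - c) 0)
    (by fun_prop) (fun t _ => ?_) hi, max_eq_right (by linarith : 0 - c ≤ 0), sub_zero]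
  split_ifs with h
  · have h1 : HasDerivWithinAt (fun t : ℝ => t - c) 1 (Set.Ioi t) t :=
      ((hasDerivAt_id t).sub_const c).hasDerivWithinAt
    refine h1.congr (fun s hs => ?_) (max_eq_left (by linarith))
    exact max_eq_left (by linarith [Set.mem_Ioi.1 hs])
  · have h1 : HasDerivAt (fun t : ℝ => max (t - c) 0) 0 t := by
      refine (hasDerivAt_const t (0 : ℝ)).congr_of_eventuallyEq ?_
      filter_upwards [eventually_lt_nhds (not_le.1 h)] with s hs
      exact max_eq_right (by linarith)
    exact h1.hasDerivWithinAt

lemma integral_N {R : ℝ} (hR : 0 ≤ R) :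
    ∫ t in (0 : ℝ)..R, (N t : ℝ)
      = 4 * Real.pi ^ 2 * ∑' n : ℤ × ℤ, cap (R / (4 * Real.pi ^ 2)) n.1 n.2 := by
  have hpi : 0 < 4 * Real.pi ^ 2 := by positivity
  set F := (diskPoints_finite R).toFinset with hF
  have hN : ∀ t ∈ Set.uIcc 0 R,
      (N t : ℝ) = ∑ n ∈ F, if (2 * Real.pi * eNorm n) ^ 2 ≤ t then (1 : ℝ) else 0 := by
    intro t ht
    rw [Set.uIcc_of_le hR] at ht
    have hset : diskPoints t
        = (F.filter fun n => (2 * Real.pi * eNorm n) ^ 2 ≤ t : Finset (ℤ × ℤ)) := by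
      ext n
      simp only [Finset.coe_filter, Set.mem_ofPred_eq, hF, Set.Finite.mem_toFinset,
        mem_diskPoints_iff ht.1, mem_diskPoints_iff hR]
      exact ⟨fun h => ⟨h.trans ht.2, h⟩, fun h => h.2⟩
    rw [N, hset, Set.ncard_coe_finset, Finset.sum_boole]
  have hcap : ∀ n : ℤ × ℤ, max (R - (2 * Real.pi * eNorm n) ^ 2) 0
      = 4 * Real.pi ^ 2 * cap (R / (4 * Real.pi ^ 2)) n.1 n.2 := by
    intro n
    rw [cap, mul_max_of_nonneg _ _ hpi.le, mul_zero, mul_pow, eNorm_sq]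
    congr 1
    field_simp
    ring
  rw [intervalIntegral.integral_congr hN, intervalIntegral.integral_finsetSum
    (fun n _ => (integral_step (sq_nonneg _) R).1), ← tsum_mul_left]
  simp_rw [(integral_step (sq_nonneg _) R).2, ← hcap]
  refine (tsum_eq_sum fun n hn => ?_).symm
  rw [hF, Set.Finite.mem_toFinset, mem_diskPoints_iff hR, not_le] at hn
  exact max_eq_right (by linarith)

lemma Psi_zero : Psi 0 = 3 * Real.pi / 8 := by
  -- substitute `u = sin x`
  have h := intervalIntegral.integral_comp_mul_deriv' (a := -(Real.pi / 2)) (b := Real.pi / 2)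
    (f := Real.sin) (f' := Real.cos) (g := fun u => (1 - u ^ 2) ^ (3 / 2 : ℝ))
    (fun x _ => Real.hasDerivAt_sin x) Real.continuous_cos.continuousOn
    (Continuous.continuousOn (Continuous.rpow_const (by fun_prop) fun _ => Or.inr (by norm_num)))
  rw [Real.sin_neg, Real.sin_pi_div_two] at h
  simp only [Psi, zero_mul, Real.cos_zero, mul_one]
  rw [← h]
  have hcos : ∀ x ∈ Set.uIcc (-(Real.pi / 2)) (Real.pi / 2),
      ((fun u : ℝ => (1 - u ^ 2) ^ (3 / 2 : ℝ)) ∘ Real.sin) x * Real.cos x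
        = Real.cos x ^ (2 + 2) := by
    intro x hx
    rw [Set.uIcc_of_le (by linarith [Real.pi_pos])] at hx
    have hc := Real.cos_nonneg_of_mem_Icc hx
    simp only [Function.comp]
    rw [← Real.cos_sq', ← Real.rpow_natCast (Real.cos x) 2, ← Real.rpow_mul hc]
    norm_num
    ring
  rw [intervalIntegral.integral_congr hcos, integral_cos_pow, integral_cos_sq]
  simp
  ring

lemma norm_Psi_mul_le : ∃ C : ℝ, 0 ≤ C ∧ ∀ z : ℝ, 1 ≤ z → |Psi z| ≤ C * z ^ (-(5 / 2) : ℝ) := by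
  simpa using Psi_expansion 0

lemma summable_Psi {r : ℝ} (hr : 1 ≤ r) : Summable fun k : ℤ × ℤ => Psi (r * eNorm k) := by
  obtain ⟨C, hC, h⟩ := norm_Psi_mul_le
  refine Summable.of_norm_bounded_eventually
    ((summable_eNorm_rpow (s := 5 / 2) (by norm_num)).mul_left C) ?_
  filter_upwards [(Set.finite_singleton (0 : ℤ × ℤ)).compl_mem_cofinite] with k hk
  have hk1 := one_le_eNorm hk
  refine (h _ (one_le_mul_of_one_le_of_one_le hr hk1)).trans
    (mul_le_mul_of_nonneg_left ?_ hC)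
  exact Real.rpow_le_rpow_of_nonpos (by linarith) (le_mul_of_one_le_left (by linarith) hr)
    (by norm_num)

/-- The exact formula behind the expansion: Poisson summation turns the average error into a series
over the nonzero frequencies, the zero frequency cancelling the area term. -/
theorem A_eq_tsum_Psi {R : ℝ} (hR : 1 ≤ R) :
    A R = R / (3 * Real.pi ^ 2) *
      ∑' k : {k : ℤ × ℤ // k ≠ 0}, Psi (Real.sqrt R * eNorm k.1) := by
  have hR0 : 0 < R := by linarith
  have hpi := Real.pi_pos
  set a := R / (4 * Real.pi ^ 2) with ha
  have ha0 : 0 < a := by positivity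
  have hroot : 2 * Real.pi * Real.sqrt a = Real.sqrt R := by
    rw [ha, Real.sqrt_div hR0.le, show 4 * Real.pi ^ 2 = (2 * Real.pi) ^ 2 by ring,
      Real.sqrt_sq (by positivity)]
    field_simp
  have hhat : ∀ k : ℤ × ℤ, capHat a k.1 k.2
      = ((4 / 3 * a ^ 2 * Psi (Real.sqrt R * eNorm k) : ℝ) : ℂ) := by
    intro k
    rw [capHat_eq_Psi ha0, hroot]
    rfl
  have hsP := summable_Psi (Real.one_le_sqrt.2 hR)
  have hP := tsum_cap_eq_tsum_capHat (a := a) (by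
    simp_rw [hhat]
    exact Complex.summable_ofReal.2 (hsP.mul_left _))
  simp_rw [hhat] at hP
  rw [← Complex.ofReal_tsum, ← Complex.ofReal_tsum, Complex.ofReal_inj, tsum_mul_left] at hP
  have hsplit := hsP.tsum_subtype_add_tsum_subtype_compl {0}
  rw [tsum_singleton (0 : ℤ × ℤ) fun k => Psi (Real.sqrt R * eNorm k)] at hsplit
  have h00 : eNorm (0 : ℤ × ℤ) = 0 := by simp [eNorm]
  rw [h00, mul_zero, Psi_zero] at hsplit
  have hcompl : ∑' k : (({0} : Set (ℤ × ℤ))ᶜ : Set (ℤ × ℤ)), Psi (Real.sqrt R * eNorm k)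
      = ∑' k : {k : ℤ × ℤ // k ≠ 0}, Psi (Real.sqrt R * eNorm k.1) := rfl
  rw [hcompl] at hsplit
  have hNi : IntervalIntegrable (fun t => (N t : ℝ)) volume 0 R :=
    Monotone.intervalIntegrable fun s t hst => Nat.cast_le.2 (N_mono hst)
  have hD : ∫ t in (0 : ℝ)..R, D t = (∫ t in (0 : ℝ)..R, (N t : ℝ)) - R ^ 2 / (8 * Real.pi) := by
    unfold D
    rw [intervalIntegral.integral_sub hNi (Continuous.intervalIntegrable (by fun_prop) _ _),
      intervalIntegral.integral_div, integral_id]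
    congr 1
    field_simp
    ring
  rw [A, hD, integral_N hR0.le, ← ha, hP, ← hsplit, ha]
  field_simp
  ring

/-! ### The expansion of the average error -/

/-- The amplitudes of the `m`-th almost periodic function (counted from `0`) in the expansion. -/
noncomputable def amplitude (m : ℕ) (k : {k : ℤ × ℤ // k ≠ 0}) : ℂ :=
  ((eNorm k.1 ^ (-(5 / 2 : ℝ) - m) / (3 * Real.pi ^ 2) : ℝ) : ℂ) * psiCoeff m

/-- The `m`-th almost periodic function (counted from `0`) in the expansion: the `m`-th terms of
the expansions of `Ψ(√R |k|)`, summed over the dual lattice. -/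
noncomputable def apTerm (m : ℕ) (x : ℝ) : ℝ :=
  expSum (amplitude m) (fun k => eNorm k.1) x

lemma summable_eNorm_ne_zero (m : ℕ) :
    Summable fun k : {k : ℤ × ℤ // k ≠ 0} => eNorm k.1 ^ (-(5 / 2 : ℝ) - m) := by
  have hm : (0 : ℝ) ≤ m := m.cast_nonneg
  have h := (summable_eNorm_rpow (s := 5 / 2 + m) (by linarith)).subtype {k | k ≠ 0}
  refine h.congr fun k => ?_
  rw [Function.comp, neg_add, ← sub_eq_add_neg]

lemma summable_amplitude (m : ℕ) : Summable fun k => ‖amplitude m k‖ := by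
  refine (((summable_eNorm_ne_zero m).div_const (3 * Real.pi ^ 2)).mul_right
    ‖psiCoeff m‖).congr fun k => ?_
  have : 0 ≤ eNorm k.1 ^ (-(5 / 2 : ℝ) - m) := Real.rpow_nonneg (Real.sqrt_nonneg _) _
  rw [amplitude, norm_mul, Complex.norm_real, Real.norm_of_nonneg (by positivity)]

lemma apTerm_zero : apTerm 0 = g := by
  funext x
  have hpi := Real.pi_pos
  have hconst : Real.sqrt 2 / Real.pi ^ (3 / 2 : ℝ)
      = 3 * Real.sqrt 2 * Real.sqrt Real.pi / (3 * Real.pi ^ 2) := by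
    have h : Real.pi ^ (3 / 2 : ℝ) * Real.sqrt Real.pi = Real.pi ^ 2 := by
      rw [Real.sqrt_eq_rpow, ← Real.rpow_add hpi]
      norm_num
    rw [← h]
    have : 0 < Real.sqrt Real.pi := Real.sqrt_pos.2 hpi
    field_simp
  rw [apTerm, expSum, g, ← tsum_mul_left]
  refine tsum_congr fun k => ?_
  have hexp : amplitude 0 k * Complex.exp ((eNorm k.1 * x : ℝ) * Complex.I)
      = ((-(Real.sqrt 2 / Real.pi ^ (3 / 2 : ℝ)) * eNorm k.1 ^ (-(5 / 2 : ℝ)) : ℝ) : ℂ)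
        * Complex.exp ((eNorm k.1 * x - Real.pi / 4 : ℝ) * Complex.I) := by
    have he : Complex.exp ((eNorm k.1 * x - Real.pi / 4 : ℝ) * Complex.I)
        = Complex.exp ((-(Real.pi / 4) : ℝ) * Complex.I)
          * Complex.exp ((eNorm k.1 * x : ℝ) * Complex.I) := by
      rw [← Complex.exp_add]
      congr 1
      push_cast
      ring
    rw [he, amplitude, psiCoeff_zero, hconst, Nat.cast_zero, sub_zero]
    push_cast
    ring
  rw [hexp, Complex.re_ofReal_mul, Complex.exp_ofReal_mul_I_re, gTerm]
  ring_nf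

lemma summable_gTerm (x : ℝ) : Summable (gTerm x) := by
  have h := summable_eNorm_ne_zero 0
  rw [Nat.cast_zero, sub_zero] at h
  refine Summable.of_norm_bounded h fun k => ?_
  have h0 : 0 ≤ eNorm k.1 ^ (-(5 / 2) : ℝ) := Real.rpow_nonneg (Real.sqrt_nonneg _) _
  rw [gTerm, norm_mul, Real.norm_of_nonneg h0]
  exact mul_le_of_le_one_right h0 (Real.abs_cos_le_one _)

/-- Sum the expansion of `Ψ` over the dual lattice, the remainders being absolutely summable. -/
theorem A_expansion (n : ℕ) :
    (fun R : ℝ => A R - ∑ m ∈ Finset.range n,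
      apTerm m (R ^ (1 / 2 : ℝ)) * R ^ (-(1 / 4 : ℝ) - (m : ℝ) / 2))
      =O[atTop] (fun R : ℝ => R ^ (-(1 / 4 : ℝ) - (n : ℝ) / 2)) := by
  obtain ⟨C, hC, hPsi⟩ := Psi_expansion n
  set S := ∑' k : {k : ℤ × ℤ // k ≠ 0}, eNorm k.1 ^ (-(5 / 2 : ℝ) - n) with hS
  refine IsBigO.of_bound (1 / (3 * Real.pi ^ 2) * (C * S)) ?_
  filter_upwards [eventually_ge_atTop 1] with R hR
  have hR0 : 0 < R := by linarith
  rw [← Real.sqrt_eq_rpow]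
  set r := Real.sqrt R with hr
  have hr1 : 1 ≤ r := Real.one_le_sqrt.2 hR
  have hr0 : 0 ≤ r := by linarith
  have hpow : ∀ m : ℕ, R ^ (-(1 / 4 : ℝ) - (m : ℝ) / 2) = R * r ^ (-(5 / 2 : ℝ) - m) := by
    intro m
    rw [hr, Real.sqrt_eq_rpow, ← Real.rpow_mul hR0.le]
    nth_rewrite 2 [← Real.rpow_one R]
    rw [← Real.rpow_add hR0]
    congr 1
    ring
  have hterm : ∀ m : ℕ, HasSum (fun k : {k : ℤ × ℤ // k ≠ 0} => R / (3 * Real.pi ^ 2) *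
      ((psiCoeff m * Complex.exp ((r * eNorm k.1 : ℝ) * Complex.I)).re
        * (r * eNorm k.1) ^ (-(5 / 2 : ℝ) - m)))
      (apTerm m r * R ^ (-(1 / 4 : ℝ) - (m : ℝ) / 2)) := by
    intro m
    have h := (summable_expSum (summable_amplitude m) (fun k => eNorm k.1) r).hasSum.mul_right
      (R ^ (-(1 / 4 : ℝ) - (m : ℝ) / 2))
    refine (congrArg (fun f => HasSum f _) (funext fun k => ?_)).mp h
    have hk : 0 ≤ eNorm k.1 := Real.sqrt_nonneg _
    rw [amplitude, mul_assoc, Complex.re_ofReal_mul, hpow, Real.mul_rpow hr0 hk,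
      mul_comm (eNorm k.1) r]
    ring
  have hPs : Summable fun k : {k : ℤ × ℤ // k ≠ 0} => Psi (r * eNorm k.1) :=
    (summable_Psi hr1).subtype _
  have hA : HasSum (fun k : {k : ℤ × ℤ // k ≠ 0} => R / (3 * Real.pi ^ 2) * Psi (r * eNorm k.1))
      (A R) := by
    rw [A_eq_tsum_Psi hR]
    exact hPs.hasSum.mul_left _
  -- one summation over `k` for the whole difference
  have hdiff := hA.sub (hasSum_sum fun m (_ : m ∈ Finset.range n) => hterm m)
  have hbound : HasSum (fun k : {k : ℤ × ℤ // k ≠ 0} =>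
      R / (3 * Real.pi ^ 2) * (C * (r ^ (-(5 / 2 : ℝ) - n) * eNorm k.1 ^ (-(5 / 2 : ℝ) - n))))
      (R / (3 * Real.pi ^ 2) * (C * (r ^ (-(5 / 2 : ℝ) - n) * S))) :=
    (((summable_eNorm_ne_zero n).hasSum.mul_left _).mul_left _).mul_left _
  rw [← hdiff.tsum_eq]
  refine (tsum_of_norm_bounded hbound fun k => ?_).trans (le_of_eq ?_)
  · have hk := one_le_eNorm k.2
    rw [← Finset.mul_sum, ← mul_sub, norm_mul, Real.norm_of_nonneg (by positivity),
      ← Real.mul_rpow hr0 (by linarith)]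
    exact mul_le_mul_of_nonneg_left (hPsi _ (one_le_mul_of_one_le_of_one_le hr1 hk))
      (by positivity)
  · rw [Real.norm_of_nonneg (Real.rpow_nonneg hR0.le _), hpow]
    ring

end LatticeDisk

theorem theorem2 :
    (∀ x : ℝ, Summable (LatticeDisk.gTerm x)) ∧
    LatticeDisk.IsUniformlyAlmostPeriodic LatticeDisk.g ∧
    LatticeDisk.HasMeanValue LatticeDisk.g 0 ∧
    (fun R : ℝ => LatticeDisk.A R - LatticeDisk.g (R ^ (1 / 2 : ℝ)) * R ^ (-(1 / 4) : ℝ))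
      =O[atTop] (fun R : ℝ => R ^ (-(3 / 4) : ℝ)) ∧
    ∃ G : ℕ → ℝ → ℝ,
      (∀ j : ℕ, 1 ≤ j → LatticeDisk.IsUniformlyAlmostPeriodic (G j)) ∧
      G 1 = LatticeDisk.g ∧
      ∀ n : ℕ, 1 ≤ n →
        (fun R : ℝ => LatticeDisk.A R -
            ∑ j ∈ Finset.Icc 1 n, G j (R ^ (1 / 2 : ℝ)) * R ^ ((1 / 4 : ℝ) - (j : ℝ) / 2))
          =O[atTop] (fun R : ℝ => R ^ (-(1 / 4 : ℝ) - (n : ℝ) / 2)) := by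
  have hap : ∀ m, LatticeDisk.IsUniformlyAlmostPeriodic (LatticeDisk.apTerm m) := fun m =>
    LatticeDisk.isUniformlyAlmostPeriodic_expSum (LatticeDisk.summable_amplitude m) _
  refine ⟨LatticeDisk.summable_gTerm, LatticeDisk.apTerm_zero ▸ hap 0, ?_, ?_,
    fun j => LatticeDisk.apTerm (j - 1), fun j _ => hap _, LatticeDisk.apTerm_zero, fun n _ => ?_⟩
  · rw [← LatticeDisk.apTerm_zero]
    exact LatticeDisk.hasMeanValue_expSum (LatticeDisk.summable_amplitude 0)
      fun k => LatticeDisk.one_le_eNorm k.2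
  · have h := LatticeDisk.A_expansion 1
    simp only [Finset.sum_range_one, LatticeDisk.apTerm_zero, Nat.cast_zero, Nat.cast_one,
      zero_div, sub_zero] at h
    norm_num at h ⊢
    exact h
  · refine (LatticeDisk.A_expansion n).congr_left fun R => ?_
    rw [Finset.range_eq_Ico, show Finset.Icc 1 n = Finset.Ico (0 + 1) (n + 1) by ext; simp,
      ← Finset.sum_Ico_add']
    congr 1
    refine Finset.sum_congr rfl fun m _ => ?_
    simp only [Nat.add_sub_cancel]
    congr 2
    push_cast
    ring
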